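/- Let $S^1=\mathbb{R}/2\pi\mathbb{Z}$, let $L^2(S^1)$ be taken with respect to $dx/2\pi$, let $C(S^1)$ act on $L^2(S^1)$ by pointwise multiplication, and let $D=-i\,\frac{d}{dx}$ be the self-adjoint operator in $L^2(S^1)$ given by the weak derivative. For $n=1,2,\dots$ let $$C^*(\mathbb{Z})_{(n)}=\Big\{x\mapsto\sum_{k\in\mathbb{Z}}a_k e^{ikx}\ :\ a=(a_k)_{k\in\mathbb Z},\ \operatorname{supp}(a)\subset(-n,n)\Big\}\subset C(S^1)\subset\mathcal{B}(L^2(S^1))$$ be the Fejér–Riesz operator system. This gives the operator system spectral triples $(C^*(\mathbb{Z})_{(n)},L^2(S^1),D)$ and $(C^\infty(S^1),L^2(S^1),D)$, with operator systems $E_n = C^*(\mathbb{Z})_{(n)}$ and $E=C(S^1)$ respectively. For an operator system spectral triple $(\mathcal{E},\mathcal{H},D)$ with $\mathcal{E}$ dense in the operator system $E\subset \mathcal{B}(\mathcal{H})$, let $\mathcal{S}(E)$ be the set of states of $E$ (positive linear functionals of norm $1$), with the (a priori $[0,\infty]$-valued) distance $$d(\varphi,\psi)=\sup\{|\varphi(T)-\psi(T)|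 : T\in\mathcal{E},\ \|[D,T]\|\le 1\}.$$ Write $d_n$ and $d$ for these distances on $\mathcal{S}(C^*(\mathbb{Z})_{(n)})$ and $\mathcal{S}(C(S^1))$. Proposition. The distances $d_n$ ($n\ge1$) and $d$ are (finite) metrics that induce the weak-$*$ topologies on the respective state spaces, so that $(\mathcal{S}(C^*(\mathbb{Z})_{(n)}),d_n)$ and $(\mathcal{S}(C(S^1)),d)$ are non-empty compact metric spaces, and $$(\mathcal{S}(C^*(\mathbb{Z})_{(n)}),d_n)\longrightarrow(\mathcal{S}(C(S^1)),d)\qquad(n\to\infty)$$ in Gromov–Hausdorff distance. -/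

import Mathlib

open MeasureTheory Filter Topology AddCircle
open scoped ENNReal InnerProductSpace ComplexOrder ContDiff Real

noncomputable section

/-! ### Operator system spectral triples, states and the distance on states -/

section General

variable {H : Type*} [NormedAddCommGroup H] [InnerProductSpace ℂ H] [CompleteSpace H]

/-- `IsCommutator D T B`: the operator `T` preserves the domain of `D`, and the commutator
`[D, T] = D T - T D` on that domain is the restriction of the bounded operator `B`. -/
def IsCommutator (D : H →ₗ.[ℂ] H) (T B : H →L[ℂ] H) : Prop :=
  ∀ ξ : D.domain, ∃ h : T (ξ : H) ∈ D.domain, D ⟨T (ξ : H), h⟩ - T (D ξ) = B (ξ : H)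

/-- `D` has compact resolvent: `D + i` is a bijection of the domain of `D` onto `H`, and its
inverse `R` is a compact operator. -/
def HasCompactResolvent (D : H →ₗ.[ℂ] H) : Prop :=
  ∃ R : H →L[ℂ] H, IsCompactOperator R ∧
    (∀ η : H, ∃ h : R η ∈ D.domain, D ⟨R η, h⟩ + Complex.I • R η = η) ∧
    ∀ ξ : D.domain, R (D ξ + Complex.I • (ξ : H)) = ξ

variable (H) in
/-- An operator system spectral triple `(𝓔, H, D)`, together with the operator system `E` in
which `𝓔` is dense. -/
structure OperatorSystemSpectralTriple where
  /-- the operator system `E ⊆ B(H)` -/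
  E : Submodule ℂ (H →L[ℂ] H)
  one_mem : 1 ∈ E
  star_mem : ∀ T ∈ E, star T ∈ E
  /-- the dense subspace `𝓔` of `E` -/
  smooth : Submodule ℂ (H →L[ℂ] H)
  smooth_le : smooth ≤ E
  le_closure : (E : Set (H →L[ℂ] H)) ⊆ closure (smooth : Set (H →L[ℂ] H))
  /-- the self-adjoint operator `D` -/
  D : H →ₗ.[ℂ] H
  isSelfAdjoint : IsSelfAdjoint D
  compactResolvent : HasCompactResolvent D
  exists_commutator : ∀ T ∈ smooth, ∃ B, IsCommutator D T B

/-- A state on an operator system `E ⊆ B(H)`: a positive linear functional of norm one. -/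
structure OperatorSystemState (E : Submodule ℂ (H →L[ℂ] H)) where
  toFun : E →L[ℂ] ℂ
  nonneg : ∀ T : E, (T : H →L[ℂ] H).IsPositive → 0 ≤ toFun T
  norm_eq_one : ‖toFun‖ = 1

namespace OperatorSystemSpectralTriple

variable (𝒯 : OperatorSystemSpectralTriple H)

/-- The state space `𝒮(E)`. -/
abbrev State : Type _ := OperatorSystemState 𝒯.E

/-- The commutator `[D, T]`, as a bounded operator, for `T ∈ 𝓔`. -/
def commutator (T : 𝒯.smooth) : H →L[ℂ] H := (𝒯.exists_commutator T T.2).choose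

theorem isCommutator_commutator (T : 𝒯.smooth) : IsCommutator 𝒯.D T (𝒯.commutator T) :=
  (𝒯.exists_commutator T T.2).choose_spec

/-- The Lipschitz semi-norm `‖T‖₁ = ‖[D, T]‖` for `T ∈ 𝓔`. -/
def lipNorm (T : 𝒯.smooth) : ℝ := ‖𝒯.commutator T‖

/-- The generalized distance
`d(φ, ψ) = sup {|φ(T) - ψ(T)| : T ∈ 𝓔, ‖T‖₁ ≤ 1}` on the state space, with values in `[0, ∞]`. -/
def stateEDist (φ ψ : 𝒯.State) : ℝ≥0∞ :=
  ⨆ (T : 𝒯.smooth) (_ : 𝒯.lipNorm T ≤ 1),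
    ‖φ.toFun (Submodule.inclusion 𝒯.smooth_le T) -
      ψ.toFun (Submodule.inclusion 𝒯.smooth_le T)‖ₑ

/-- The weak-* topology on the state space. -/
abbrev weakStarTopology : TopologicalSpace 𝒯.State :=
  TopologicalSpace.induced (fun φ => StrongDual.toWeakDual φ.toFun)
    (inferInstance : TopologicalSpace (WeakDual ℂ 𝒯.E))

/-- The metric `m` on the state space is the distance `d`, and its topology is the weak-*
topology. -/
structure IsStateMetric (m : MetricSpace 𝒯.State) : Prop where
  edist_eq : ∀ φ ψ : 𝒯.State, m.edist φ ψ = 𝒯.stateEDist φ ψ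
  topology_eq : m.toUniformSpace.toTopologicalSpace = 𝒯.weakStarTopology

end OperatorSystemSpectralTriple

/-- The bounded commutator is unique, as the domain of a self-adjoint operator is dense. -/
theorem IsCommutator.unique {H : Type*} [NormedAddCommGroup H] [InnerProductSpace ℂ H]
    {D : H →ₗ.[ℂ] H} (hD : Dense (D.domain : Set H))
    {T B B' : H →L[ℂ] H} (h : IsCommutator D T B) (h' : IsCommutator D T B') : B = B' := by
  have : (B : H → H) = B' := by
    refine Continuous.ext_on hD B.continuous B'.continuous fun ξ hξ => ?_
    obtain ⟨_, e⟩ := h ⟨ξ, hξ⟩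
    obtain ⟨_, e'⟩ := h' ⟨ξ, hξ⟩
    exact e.symm.trans e'
  exact DFunLike.coe_injective this

end General

/-! ### The circle `S¹ = ℝ / 2πℤ`, multiplication operators and `D = -i d/dx` -/

namespace CircleTriple

instance fact_two_pi_pos : Fact (0 < 2 * π) := ⟨Real.two_pi_pos⟩

/-- The circle, with coordinate `x` modulo `2π`. -/
abbrev S1 : Type := AddCircle (2 * π)

/-- `L²(S¹)` for the measure `dx / 2π`. -/
abbrev L2 : Type := Lp ℂ 2 (haarAddCircle (T := 2 * π))

/-- The class in `L²(S¹)` of a continuous function. -/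
abbrev toL2 : C(S1, ℂ) →L[ℂ] L2 := ContinuousMap.toLp 2 haarAddCircle ℂ

/-- The representation of `C(S¹)` on `L²(S¹)` by pointwise multiplication. -/
def mulOp : C(S1, ℂ) →L[ℂ] L2 →L[ℂ] L2 :=
  ((ContinuousLinearMap.mul ℂ ℂ).holderL haarAddCircle ∞ 2 2).comp
    (ContinuousMap.toLp ∞ haarAddCircle ℂ)

/-- `f'` is the derivative of the function `f` on the circle. -/
def IsDeriv (f f' : C(S1, ℂ)) : Prop :=
  ∀ t : ℝ, HasDerivAt (fun s : ℝ => f (s : S1)) (f' (t : S1)) t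

/-- The graph of `-i d/dx` on `L²(S¹)`, where the derivative is the weak derivative: `(ξ, η)`
belongs to it iff `⟪φ, η⟫ = ⟪-i φ', ξ⟫` for all `C¹` test functions `φ` on the circle. -/
def diracGraph : Submodule ℂ (L2 × L2) where
  carrier := {p | ∀ φ φ' : C(S1, ℂ), IsDeriv φ φ' →
    ⟪toL2 φ, p.2⟫_ℂ = ⟪toL2 (-Complex.I • φ'), p.1⟫_ℂ}
  zero_mem' := by intro φ φ' _; simp
  add_mem' := by
    intro p q hp hq φ φ' h
    simp only [Prod.fst_add, Prod.snd_add, inner_add_right, hp φ φ' h, hq φ φ' h]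
  smul_mem' := by
    intro c p hp φ φ' h
    simp only [Prod.smul_fst, Prod.smul_snd, inner_smul_right, hp φ φ' h]

/-- The operator `D = -i d/dx` in `L²(S¹)`. -/
def dirac : L2 →ₗ.[ℂ] L2 := diracGraph.toLinearPMap

theorem coeFn_mulOp (f : C(S1, ℂ)) (ξ : L2) :
    mulOp f ξ =ᵐ[haarAddCircle] fun x => f x * ξ x := by
  have h1 : mulOp f ξ = (ContinuousLinearMap.mul ℂ ℂ).holder 2
    (ContinuousMap.toLp ∞ haarAddCircle ℂ f) ξ := rfl
  rw [h1]
  filter_upwards [(ContinuousLinearMap.mul ℂ ℂ).coeFn_holder (r := 2)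
    (ContinuousMap.toLp ∞ haarAddCircle ℂ f) ξ,
    ContinuousMap.coeFn_toLp (p := ∞) (𝕜 := ℂ) haarAddCircle f] with x h2 h3
  rw [h2, h3]; rfl

theorem mulOp_toL2 (f g : C(S1, ℂ)) : mulOp f (toL2 g) = toL2 (f * g) := by
  apply Lp.ext
  filter_upwards [coeFn_mulOp f (toL2 g),
    ContinuousMap.coeFn_toLp (p := 2) (𝕜 := ℂ) haarAddCircle g,
    ContinuousMap.coeFn_toLp (p := 2) (𝕜 := ℂ) haarAddCircle (f * g)] with x h1 h2 h3
  rw [h1, h2, h3]; rfl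

theorem inner_mulOp (f : C(S1, ℂ)) (ξ η : L2) : ⟪ξ, mulOp f η⟫_ℂ = ⟪mulOp (star f) ξ, η⟫_ℂ := by
  rw [L2.inner_def, L2.inner_def]
  apply integral_congr_ae
  filter_upwards [coeFn_mulOp f η, coeFn_mulOp (star f) ξ] with x h1 h2
  rw [h1, h2]
  simp [mul_comm, mul_left_comm]

theorem star_mulOp (f : C(S1, ℂ)) : star (mulOp f) = mulOp (star f) := by
  rw [ContinuousLinearMap.star_eq_adjoint]
  symm
  rw [ContinuousLinearMap.eq_adjoint_iff]
  intro x y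
  rw [inner_mulOp]

theorem mulOp_one : mulOp 1 = 1 := by
  ext1 ξ
  apply Lp.ext
  filter_upwards [coeFn_mulOp 1 ξ] with x h1
  rw [h1]; simp

theorem isDeriv_fourier (k : ℤ) :
    IsDeriv (fourier k) ((Complex.I * k) • fourier k) := by
  intro t
  have := hasDerivAt_fourier (2 * π) k t
  convert this using 1
  simp only [ContinuousMap.smul_apply, smul_eq_mul]
  congr 1
  have : (π : ℂ) ≠ 0 := by exact_mod_cast Real.pi_ne_zero
  push_cast
  field_simp

theorem fourierBasis_apply (k : ℤ) : fourierBasis (T := 2 * π) k = toL2 (fourier k) := by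
  rw [coe_fourierBasis]

/-- Fourier coefficients of derivatives. -/
theorem inner_deriv {φ φ' : C(S1, ℂ)} (h : IsDeriv φ φ') (k : ℤ) :
    ⟪toL2 (-Complex.I • φ'), toL2 (fourier k)⟫_ℂ = k * ⟪toL2 φ, toL2 (fourier k)⟫_ℂ := by
  have key : ∀ g g' : C(S1, ℂ), IsDeriv g g' → ∫ x, g' x ∂(haarAddCircle (T := 2 * π)) = 0 := by
    intro g g' hg
    rw [integral_haarAddCircle, ← AddCircle.intervalIntegral_preimage (2 * π) 0,
      intervalIntegral.integral_eq_sub_of_hasDerivAt (f := fun s : ℝ => g (s : S1))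
        (fun t _ => hg t)]
    · rw [zero_add, AddCircle.coe_period]
      simp
    · apply Continuous.intervalIntegrable
      exact g'.continuous.comp (AddCircle.continuous_mk' _)
  have h2 := key (fourier k * star φ) ((Complex.I * k) • fourier k * star φ + fourier k * star φ')
    (fun t => (isDeriv_fourier k t).mul (h t).star)
  rw [ContinuousMap.inner_toLp, ContinuousMap.inner_toLp]
  have i1 : Integrable (fun x : S1 => fourier k x * star (φ x)) haarAddCircle :=
    (fourier k * star φ : C(S1, ℂ)).continuous.integrable_of_hasCompactSupport
      (HasCompactSupport.of_compactSpace _)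
  have i2 : Integrable (fun x : S1 => fourier k x * star (φ' x)) haarAddCircle :=
    (fourier k * star φ' : C(S1, ℂ)).continuous.integrable_of_hasCompactSupport
      (HasCompactSupport.of_compactSpace _)
  have h3 : Complex.I * k * ∫ x : S1, fourier k x * star (φ x) ∂haarAddCircle +
      ∫ x : S1, fourier k x * star (φ' x) ∂haarAddCircle = 0 := by
    rw [← integral_const_mul, ← integral_add (i1.const_mul _) i2, ← h2]
    refine integral_congr_ae (Eventually.of_forall fun x => ?_)
    simp [mul_assoc]
  have h4 : ∫ x : S1, fourier k x * (starRingEnd ℂ) ((-Complex.I • φ') x) ∂haarAddCircle =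
      Complex.I * ∫ x : S1, fourier k x * star (φ' x) ∂haarAddCircle := by
    rw [← integral_const_mul]
    refine integral_congr_ae (Eventually.of_forall fun x => ?_)
    simp; ring
  rw [h4]
  have h5 : ∫ x : S1, fourier k x * (starRingEnd ℂ) (φ x) ∂haarAddCircle =
    ∫ x : S1, fourier k x * star (φ x) ∂haarAddCircle := rfl
  rw [h5]
  have := Complex.I_mul_I
  linear_combination Complex.I * h3 - (k * ∫ x : S1, fourier k x * star (φ x) ∂haarAddCircle) * this

/-- In terms of Fourier coefficients, `D` is multiplication by `k`. -/
theorem mem_diracGraph_iff {ξ η : L2} :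
    (ξ, η) ∈ diracGraph ↔ ∀ k : ℤ, ⟪toL2 (fourier k), η⟫_ℂ = k * ⟪toL2 (fourier k), ξ⟫_ℂ := by
  constructor
  · intro h k
    have := Complex.I_mul_I
    rw [h _ _ (isDeriv_fourier k), map_smul, map_smul, inner_smul_left, inner_smul_left]
    simp only [map_neg, map_mul, Complex.conj_I, map_intCast]
    linear_combination (-k * ⟪toL2 (fourier k), ξ⟫_ℂ) * this
  · intro h φ φ' hd
    rw [← (fourierBasis (T := 2 * π)).tsum_inner_mul_inner,
      ← (fourierBasis (T := 2 * π)).tsum_inner_mul_inner]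
    congr 1; ext k
    simp only [fourierBasis_apply]
    rw [h k, inner_deriv hd k]
    ring

theorem ext_coeff {ξ η : L2}
    (h : ∀ k : ℤ, ⟪toL2 (fourier k), ξ⟫_ℂ = ⟪toL2 (fourier k), η⟫_ℂ) : ξ = η := by
  apply (fourierBasis (T := 2 * π)).repr.injective
  ext k
  simp only [HilbertBasis.repr_apply_apply, fourierBasis_apply, h k]

theorem diracGraph_unique (p : L2 × L2) (hp : p ∈ diracGraph) (h0 : p.1 = 0) : p.2 = 0 := by
  obtain ⟨ξ, η⟩ := p
  refine ext_coeff fun k => ?_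
  have := mem_diracGraph_iff.1 hp k
  simp only at h0 ⊢
  rw [this, h0]; simp

theorem graph_dirac : dirac.graph = diracGraph :=
  diracGraph.toLinearPMap_graph_eq diracGraph_unique

/-- The defining property of `D = -i d/dx`. -/
theorem dirac_mem_diracGraph (ξ : dirac.domain) : ((ξ : L2), dirac ξ) ∈ diracGraph := by
  rw [← graph_dirac]; exact dirac.mem_graph ξ

theorem exists_dirac_eq {ξ η : L2} (h : (ξ, η) ∈ diracGraph) :
    ∃ h : ξ ∈ dirac.domain, dirac ⟨ξ, h⟩ = η := by
  rw [← graph_dirac, LinearPMap.mem_graph_iff] at h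
  obtain ⟨y, h1, h2⟩ := h
  simp only at h1 h2
  subst h1
  exact ⟨y.2, h2⟩

theorem isDeriv_mem_diracGraph {f f' : C(S1, ℂ)} (h : IsDeriv f f') :
    (toL2 f, toL2 (-Complex.I • f')) ∈ diracGraph := by
  rw [mem_diracGraph_iff]
  intro k
  rw [← inner_conj_symm, inner_deriv h k, map_mul, inner_conj_symm, map_intCast]

theorem dense_dirac_domain : Dense (dirac.domain : Set L2) := by
  have h := (fourierBasis (T := 2 * π)).dense_span
  rw [← Submodule.dense_iff_topologicalClosure_eq_top] at h
  refine h.mono ?_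
  rw [SetLike.coe_subset_coe, Submodule.span_le]
  rintro _ ⟨k, rfl⟩
  rw [fourierBasis_apply]
  exact (exists_dirac_eq (isDeriv_mem_diracGraph (isDeriv_fourier k))).choose

theorem isSelfAdjoint_dirac : IsSelfAdjoint dirac := by
  rw [LinearPMap.isSelfAdjoint_def]
  apply le_antisymm
  · have key : ∀ y : dirac.adjoint.domain, ((y : L2), dirac.adjoint y) ∈ diracGraph := by
      intro y φ φ' h
      obtain ⟨h1, h2⟩ := exists_dirac_eq (isDeriv_mem_diracGraph h)
      have := dirac.adjoint_isFormalAdjoint dense_dirac_domain y ⟨_, h1⟩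
      rw [h2] at this
      rw [← inner_conj_symm, this, inner_conj_symm]
    refine ⟨fun y hy => (exists_dirac_eq (key ⟨y, hy⟩)).choose, fun y z hyz => ?_⟩
    obtain ⟨h1, h2⟩ := exists_dirac_eq (key y)
    rw [← h2]
    congr 1
    exact Subtype.ext hyz
  · apply LinearPMap.IsFormalAdjoint.le_adjoint dense_dirac_domain
    intro ξ η
    have h1 := mem_diracGraph_iff.1 (dirac_mem_diracGraph ξ)
    have h2 := mem_diracGraph_iff.1 (dirac_mem_diracGraph η)
    rw [← (fourierBasis (T := 2 * π)).tsum_inner_mul_inner,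
      ← (fourierBasis (T := 2 * π)).tsum_inner_mul_inner]
    congr 1; ext k
    simp only [fourierBasis_apply]
    rw [h2 k, ← inner_conj_symm, h1 k, map_mul, inner_conj_symm, map_intCast]
    ring

/-- Diagonal operators in the Fourier basis. -/
theorem exists_diagonal (b : ℤ → ℂ) (C : ℝ) (hC : 0 ≤ C) (hb : ∀ k, ‖b k‖ ≤ C) :
    ∃ R : L2 →L[ℂ] L2, ‖R‖ ≤ C ∧
      ∀ ξ k, ⟪toL2 (fourier k), R ξ⟫_ℂ = b k * ⟪toL2 (fourier k), ξ⟫_ℂ := by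
  let e := (fourierBasis (T := 2 * π)).repr
  have hle : ∀ (x : lp (fun _ : ℤ => ℂ) 2) (k : ℤ),
      ‖b k * x k‖ ≤ ‖((C : ℂ) • x : lp (fun _ : ℤ => ℂ) 2) k‖ := by
    intro x k
    rw [lp.coeFn_smul, Pi.smul_apply, norm_smul, norm_mul, Complex.norm_real,
      Real.norm_of_nonneg hC]
    gcongr
    exact hb k
  have hmem : ∀ x : lp (fun _ : ℤ => ℂ) 2, Memℓp (fun k => b k * x k) 2 := fun x =>
    (lp.memℓp ((C : ℂ) • x)).mono' (hle x)
  let M : lp (fun _ : ℤ => ℂ) 2 →ₗ[ℂ] lp (fun _ : ℤ => ℂ) 2 :=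
    { toFun := fun x => ⟨fun k => b k * x k, hmem x⟩
      map_add' := by
        intro x y; ext k
        change b k * (x k + y k) = b k * x k + b k * y k
        ring
      map_smul' := by
        intro c x; ext k
        change b k * (c * x k) = c * (b k * x k)
        ring }
  have hM : ∀ x, ‖M x‖ ≤ C * ‖x‖ := by
    intro x
    have : ‖M x‖ ≤ ‖(C : ℂ) • x‖ := lp.norm_mono (by norm_num) (hle x)
    rwa [norm_smul, Complex.norm_real, Real.norm_of_nonneg hC] at this
  refine ⟨LinearMap.mkContinuous (e.symm.toLinearEquiv.toLinearMap ∘ₗ M ∘ₗ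
    e.toLinearEquiv.toLinearMap) C ?_, LinearMap.mkContinuous_norm_le _ hC _, ?_⟩
  · intro ξ
    change ‖e.symm (M (e ξ))‖ ≤ _
    rw [LinearIsometryEquiv.norm_map]
    simpa using hM (e ξ)
  · intro ξ k
    change ⟪toL2 (fourier k), e.symm (M (e ξ))⟫_ℂ = _
    rw [← fourierBasis_apply, ← HilbertBasis.repr_apply_apply, ← HilbertBasis.repr_apply_apply]
    change e (e.symm (M (e ξ))) k = _
    rw [LinearIsometryEquiv.apply_symm_apply]
    rfl

theorem norm_inv_le (k : ℤ) : ‖((k : ℂ) + Complex.I)⁻¹‖ ≤ 1 ∧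
    ∀ N : ℕ, (N : ℤ) < |k| → ‖((k : ℂ) + Complex.I)⁻¹‖ ≤ 1 / ((N : ℝ) + 1) := by
  have h1 : |(1 : ℝ)| ≤ ‖(k : ℂ) + Complex.I‖ := by
    have := Complex.abs_im_le_norm ((k : ℂ) + Complex.I)
    simpa using this
  have h2 : |(k : ℝ)| ≤ ‖(k : ℂ) + Complex.I‖ := by
    have := Complex.abs_re_le_norm ((k : ℂ) + Complex.I)
    simpa using this
  rw [abs_one] at h1
  rw [norm_inv]
  refine ⟨inv_le_one_of_one_le₀ h1, fun N hN => ?_⟩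
  rw [← one_div]
  apply one_div_le_one_div_of_le (by positivity)
  refine le_trans ?_ h2
  have : ((N : ℤ) + 1 : ℤ) ≤ |k| := hN
  exact_mod_cast this

theorem hasCompactResolvent_dirac : HasCompactResolvent dirac := by
  have hne : ∀ k : ℤ, (k : ℂ) + Complex.I ≠ 0 := by
    intro k h
    have := congrArg Complex.im h
    simp at this
  obtain ⟨R, -, hR⟩ := exists_diagonal (fun k => ((k : ℂ) + Complex.I)⁻¹) 1 zero_le_one
    (fun k => (norm_inv_le k).1)
  refine ⟨R, ?_, ?_, ?_⟩
  · let F : ℕ → L2 →L[ℂ] L2 := fun N => ∑ k ∈ Finset.Icc (-N : ℤ) N,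
      (innerSL ℂ (toL2 (fourier k))).smulRight (((k : ℂ) + Complex.I)⁻¹ • toL2 (fourier k))
    have hF : ∀ N, IsCompactOperator (F N) := by
      intro N
      change F N ∈ compactOperator (RingHom.id ℂ) L2 L2
      refine Submodule.sum_mem _ fun k _ => ?_
      exact (isCompactOperator_of_locallyCompactSpace_dom (innerSL ℂ (toL2 (fourier k)))).clm_comp
        ((ContinuousLinearMap.id ℂ ℂ).smulRight (((k : ℂ) + Complex.I)⁻¹ • toL2 (fourier k)))
    have horth : ∀ j k : ℤ, ⟪toL2 (fourier j), toL2 (fourier k)⟫_ℂ = if j = k then 1 else 0 := by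
      intro j k
      rw [← fourierBasis_apply, ← fourierBasis_apply]
      exact orthonormal_iff_ite.1 (fourierBasis (T := 2 * π)).orthonormal j k
    have hFN : ∀ (N : ℕ) (ξ : L2) (j : ℤ), ⟪toL2 (fourier j), F N ξ⟫_ℂ =
        (if |j| ≤ (N : ℤ) then ((j : ℂ) + Complex.I)⁻¹ else 0) * ⟪toL2 (fourier j), ξ⟫_ℂ := by
      intro N ξ j
      simp only [F, sum_apply, ContinuousLinearMap.smulRight_apply,
        innerSL_apply_apply, inner_sum, inner_smul_right, horth, mul_ite, mul_one, mul_zero,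
        Finset.sum_ite_eq, Finset.mem_Icc, ← abs_le]
      split_ifs <;> ring
    refine isCompactOperator_of_tendsto (F := F) (l := atTop) ?_ (Eventually.of_forall hF)
    rw [tendsto_iff_norm_sub_tendsto_zero]
    refine squeeze_zero (fun _ => norm_nonneg _) (fun N => ?_)
      tendsto_one_div_add_atTop_nhds_zero_nat
    obtain ⟨S, hS1, hS2⟩ := exists_diagonal
      (fun k => if |k| ≤ (N : ℤ) then 0 else ((k : ℂ) + Complex.I)⁻¹) (1 / ((N : ℝ) + 1))
      (by positivity) (by
        intro k
        split_ifs with h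
        · simp only [norm_zero]; positivity
        · exact (norm_inv_le k).2 N (not_le.1 h))
    have : F N - R = -S := by
      ext1 ξ
      refine ext_coeff fun k => ?_
      rw [sub_apply, inner_sub_right, hFN, hR, neg_apply,
        inner_neg_right, hS2]
      split_ifs <;> ring
    rw [this, norm_neg]
    exact hS1
  · intro η
    have : (R η, η - Complex.I • R η) ∈ diracGraph := by
      rw [mem_diracGraph_iff]
      intro k
      rw [inner_sub_right, inner_smul_right, hR]
      have := hne k
      field_simp
      ring
    obtain ⟨h1, h2⟩ := exists_dirac_eq this
    exact ⟨h1, by rw [h2]; abel⟩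
  · intro ξ
    refine ext_coeff fun k => ?_
    rw [hR, inner_add_right, inner_smul_right,
      mem_diracGraph_iff.1 (dirac_mem_diracGraph ξ) k]
    have := hne k
    field_simp

theorem isCommutator_dirac {f f' : C(S1, ℂ)} (h : IsDeriv f f') :
    IsCommutator dirac (mulOp f) (mulOp (-Complex.I • f')) := by
  intro ξ
  have hξ := dirac_mem_diracGraph ξ
  have : (mulOp f (ξ : L2), mulOp f (dirac ξ) + mulOp (-Complex.I • f') ξ) ∈ diracGraph := by
    intro φ φ' hφ
    have hd : IsDeriv (star f * φ) (star f' * φ + star f * φ') :=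
      fun t => (h t).star.mul (hφ t)
    have e := hξ _ _ hd
    simp only [inner_add_right, inner_mulOp, mulOp_toL2] at e ⊢
    rw [e, ← inner_add_left, ← map_add]
    congr 2
    ext x
    simp
  obtain ⟨h1, h2⟩ := exists_dirac_eq this
  exact ⟨h1, by rw [h2]; abel⟩

/-! ### The circle and the Fejér–Riesz operator systems -/

/-- Smooth functions on the circle. -/
def smoothFunctions : Submodule ℂ C(S1, ℂ) where
  carrier := {f | ContDiff ℝ ∞ fun t : ℝ => f (t : S1)}
  zero_mem' := (contDiff_const : ContDiff ℝ ∞ fun _ : ℝ => (0 : ℂ))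
  add_mem' := by
    intro f g hf hg
    rw [Set.mem_ofPred_eq] at hf hg
    exact hf.add hg
  smul_mem' := by
    intro c f hf
    rw [Set.mem_ofPred_eq] at hf
    exact hf.const_smul c

/-- The sequence `a` viewed as the function `x ↦ ∑ₖ aₖ e^{ikx}` on the circle. -/
def trigPoly : (ℤ →₀ ℂ) →ₗ[ℂ] C(S1, ℂ) :=
  Finsupp.linearCombination ℂ fun k : ℤ => (fourier k : C(S1, ℂ))

/-- The Fejér–Riesz operator system `C*(ℤ)₍ₙ₎` of sequences supported in `(-n, n)`, as a subspace
of `C(S¹)`. -/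
def fejerRiesz (n : ℕ+) : Submodule ℂ C(S1, ℂ) :=
  (Finsupp.supported ℂ ℂ (Set.Ioo (-(n : ℤ)) (n : ℤ))).map trigPoly

theorem exists_isDeriv {f : C(S1, ℂ)} (hf : f ∈ smoothFunctions) : ∃ f', IsDeriv f f' := by
  have hf : ContDiff ℝ ∞ fun t : ℝ => f (t : S1) := hf
  have hp : Function.Periodic (deriv fun t : ℝ => f (t : S1)) (2 * π) := by
    intro t
    rw [← deriv_comp_add_const]
    simp
  have hc : Continuous (deriv fun t : ℝ => f (t : S1)) := hf.continuous_deriv (by simp)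
  refine ⟨⟨hp.lift, ?_⟩, fun t => ?_⟩
  · exact continuous_coinduced_dom.mpr hc
  · exact (hf.differentiable (by simp) t).hasDerivAt

theorem fejerRiesz_eq_span (n : ℕ+) : fejerRiesz n =
    Submodule.span ℂ ((fun k : ℤ => (fourier k : C(S1, ℂ))) '' Set.Ioo (-(n : ℤ)) (n : ℤ)) :=
  (Finsupp.span_image_eq_map_linearCombination ..).symm

theorem fourier_mem_smooth (k : ℤ) : (fourier k : C(S1, ℂ)) ∈ smoothFunctions := by
  change ContDiff ℝ ∞ fun t : ℝ => (fourier k : C(S1, ℂ)) (t : S1)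
  simp only [fourier_coe_apply]
  exact ((contDiff_const.mul Complex.ofRealCLM.contDiff).div_const _).cexp

theorem fejerRiesz_le_smooth (n : ℕ+) : fejerRiesz n ≤ smoothFunctions := by
  rw [fejerRiesz_eq_span, Submodule.span_le]
  rintro _ ⟨k, -, rfl⟩
  exact fourier_mem_smooth k

theorem star_mem_fejerRiesz (n : ℕ+) {f : C(S1, ℂ)} (hf : f ∈ fejerRiesz n) :
    star f ∈ fejerRiesz n := by
  rw [fejerRiesz_eq_span] at hf ⊢
  induction hf using Submodule.span_induction with
  | mem x hx =>
    obtain ⟨k, hk, rfl⟩ := hx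
    refine Submodule.subset_span ⟨-k, ⟨by have := hk.2; omega, by have := hk.1; omega⟩, ?_⟩
    ext x
    exact fourier_neg
  | zero => simp
  | add x y _ _ hx hy => rw [star_add]; exact add_mem hx hy
  | smul c x _ hx => rw [star_smul]; exact Submodule.smul_mem _ _ hx

theorem one_mem_fejerRiesz (n : ℕ+) : (1 : C(S1, ℂ)) ∈ fejerRiesz n := by
  rw [fejerRiesz_eq_span]
  have := n.pos
  refine Submodule.subset_span ⟨0, ⟨by simp, by simp⟩, ?_⟩
  ext x
  exact fourier_zero

theorem dense_smooth : Dense (smoothFunctions : Set C(S1, ℂ)) := by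
  have h := span_fourier_closure_eq_top (T := 2 * π)
  rw [← Submodule.dense_iff_topologicalClosure_eq_top] at h
  refine h.mono ?_
  rw [SetLike.coe_subset_coe, Submodule.span_le]
  rintro _ ⟨k, rfl⟩
  exact fourier_mem_smooth k

theorem exists_commutator_of_smooth {f : C(S1, ℂ)} (hf : f ∈ smoothFunctions) :
    ∃ B, IsCommutator dirac (mulOp f) B := by
  obtain ⟨f', h⟩ := exists_isDeriv hf
  exact ⟨_, isCommutator_dirac h⟩

/-- The spectral triple `(C^∞(S¹), L²(S¹), -i d/dx)` of the circle, with operator system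
`C(S¹)`. -/
def circle : OperatorSystemSpectralTriple L2 where
  E := LinearMap.range mulOp.toLinearMap
  one_mem := ⟨1, mulOp_one⟩
  star_mem := by
    rintro _ ⟨f, rfl⟩
    exact ⟨star f, (star_mulOp f).symm⟩
  smooth := smoothFunctions.map mulOp.toLinearMap
  smooth_le := by
    rintro _ ⟨f, -, rfl⟩
    exact ⟨f, rfl⟩
  le_closure := by
    rintro _ ⟨f, rfl⟩
    exact image_closure_subset_closure_image mulOp.continuous ⟨f, dense_smooth f, rfl⟩
  D := dirac
  isSelfAdjoint := isSelfAdjoint_dirac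
  compactResolvent := hasCompactResolvent_dirac
  exists_commutator := by
    rintro _ ⟨f, hf, rfl⟩
    exact exists_commutator_of_smooth hf

/-- The operator system spectral triple `(C*(ℤ)₍ₙ₎, L²(S¹), -i d/dx)`. -/
def fejerRieszTriple (n : ℕ+) : OperatorSystemSpectralTriple L2 where
  E := (fejerRiesz n).map mulOp.toLinearMap
  one_mem := ⟨1, one_mem_fejerRiesz n, mulOp_one⟩
  star_mem := by
    rintro _ ⟨f, hf, rfl⟩
    exact ⟨star f, star_mem_fejerRiesz n hf, (star_mulOp f).symm⟩
  smooth := (fejerRiesz n).map mulOp.toLinearMap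
  smooth_le := le_rfl
  le_closure := subset_closure
  D := dirac
  isSelfAdjoint := isSelfAdjoint_dirac
  compactResolvent := hasCompactResolvent_dirac
  exists_commutator := by
    rintro _ ⟨f, hf, rfl⟩
    exact exists_commutator_of_smooth (fejerRiesz_le_smooth n hf)

end CircleTriple
end

/-! ### Positive functionals on operator systems -/

section PositiveFunctionals

variable {H : Type*} [NormedAddCommGroup H] [InnerProductSpace ℂ H] [CompleteSpace H]

/-! The proof compares the two state spaces by two maps: restriction of states, and precomposition
with the Fejér map. The latter sends an operator `T` to the function `x ↦ n⁻¹⟪v_x, T v_x⟫`, where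
`v_x = ∑_{0 ≤ j < n} e^{-ijx} e_j` has norm `√n`. This map is positive, unital and contractive, it
takes values in the Fejér–Riesz system, and it commutes with `[D, ·]` (`isCommutator_fejerSymbol`),
so it does not increase the Lipschitz seminorm. It moves a function with `‖f'‖ ≤ 1` by at most
`π/√n` (`norm_fejerSymbol_mulOp_sub_le`). Hence both maps of state spaces are 1-Lipschitz and both
round trips are `π/√n`-close to the identity, which gives a Gromov–Hausdorff distance of at most
`2π/√n`.

The same map shows that the distances are metrics for the weak-* topologies. Up to `π/√n`, every
element of the Lipschitz ball is a trigonometric polynomial whose nonconstant coefficients are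
bounded uniformly, so the distance of two states is controlled by finitely many characters
(`IsCircular.norm_sub_le`). It is therefore finite and weak-* continuous, and weak-* compactness of
the state space makes the two topologies equal. -/

theorem isPositive_norm_smul_one_sub {A : H →L[ℂ] H} (hA : IsSelfAdjoint A) :
    ((‖A‖ : ℂ) • (1 : H →L[ℂ] H) - A).IsPositive := by
  have h := hA.le_algebraMap_norm_self
  rw [← sub_nonneg, ContinuousLinearMap.nonneg_iff_isPositive] at h
  convert h using 2
  ext ξ
  rw [ContinuousLinearMap.algebraMap_apply]
  simp

/-- A positive functional on an operator system is bounded by its value at the unit. -/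
theorem norm_le_of_positive {E : Submodule ℂ (H →L[ℂ] H)} (h1 : 1 ∈ E)
    (hs : ∀ T ∈ E, star T ∈ E) (φ : E →L[ℂ] ℂ)
    (hφ : ∀ T : E, (T : H →L[ℂ] H).IsPositive → 0 ≤ φ T) (T : E) :
    ‖φ T‖ ≤ (φ ⟨1, h1⟩).re * ‖T‖ := by
  have hsa : ∀ A : E, IsSelfAdjoint (A : H →L[ℂ] H) →
      (φ A).im = 0 ∧ (φ A).re ≤ ‖A‖ * (φ ⟨1, h1⟩).re := by
    intro A hA
    have h1' := hφ ⟨1, h1⟩ ContinuousLinearMap.isPositive_one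
    have h2 := hφ ((‖A‖ : ℂ) • (⟨1, h1⟩ : E) - A) (isPositive_norm_smul_one_sub hA)
    rw [map_sub, map_smul, Complex.nonneg_iff] at h2
    rw [Complex.nonneg_iff] at h1'
    simp only [smul_eq_mul, Complex.sub_re, Complex.re_ofReal_mul, Complex.sub_im,
      Complex.im_ofReal_mul, ← h1'.2] at h2
    constructor <;> linarith [h2.1, h2.2]
  -- A phase reduces the bound to a self-adjoint element: `φ` takes the value `‖φ T‖` at `S = cT`,
  -- hence also, in real part, at `(S + S*)/2`. No Cauchy–Schwarz inequality is used, since `E` need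
  -- not be closed under products.
  obtain ⟨c, hc, hcT⟩ : ∃ c : ℂ, ‖c‖ = 1 ∧ c * φ T = ‖φ T‖ := by
    obtain ⟨c, hc, h⟩ := RCLike.exists_norm_eq_mul_self (φ T)
    exact ⟨c, hc, h.symm⟩
  set S : E := c • T with hS
  have hSn : ‖S‖ = ‖T‖ := by rw [hS, norm_smul, hc, one_mul]
  set S' : E := ⟨star (S : H →L[ℂ] H), hs _ S.2⟩ with hS'
  have hS'n : ‖S'‖ = ‖S‖ := norm_star (S : H →L[ℂ] H)
  obtain ⟨-, hA⟩ := hsa ((1 / 2 : ℂ) • (S + S')) (by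
    simp [isSelfAdjoint_iff, hS', add_comm])
  -- Reality of `φ` at the self-adjoint element `(i/2)(S - S*)` says that `φ S'` has real part `φ
  -- S`.
  obtain ⟨hB, -⟩ := hsa ((Complex.I / 2 : ℂ) • (S - S')) (by
    simp only [isSelfAdjoint_iff, hS', Submodule.coe_smul, Submodule.coe_sub, star_smul, star_sub,
      star_star]
    rw [← neg_sub, smul_neg, ← neg_smul]
    congr 1
    simp [neg_div])
  have hnorm : ‖((1 / 2 : ℂ) • (S + S') : E)‖ ≤ ‖T‖ := by
    have h := norm_add_le S S'
    rw [hS'n, hSn] at h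
    rw [norm_smul, show ‖(1 / 2 : ℂ)‖ = 1 / 2 by norm_num]
    linarith
  have h1' : 0 ≤ (φ ⟨1, h1⟩).re :=
    (Complex.nonneg_iff.1 (hφ ⟨1, h1⟩ ContinuousLinearMap.isPositive_one)).1
  have hφS : φ S = ‖φ T‖ := by rw [hS, map_smul, smul_eq_mul, hcT]
  rw [map_smul, map_add, hφS] at hA
  rw [map_smul, map_sub, hφS] at hB
  have hb : ((1 / 2 : ℂ) * (‖φ T‖ + φ S')).re = ‖φ T‖ := by
    simp at hB ⊢
    linarith
  rw [smul_eq_mul, hb] at hA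
  rw [mul_comm]
  exact hA.trans (mul_le_mul_of_nonneg_right hnorm h1')

end PositiveFunctionals

/-! ### States as unital positive functionals -/

namespace OperatorSystemState

variable {H : Type*} [NormedAddCommGroup H] [InnerProductSpace ℂ H] [CompleteSpace H]
  {E : Submodule ℂ (H →L[ℂ] H)}

theorem toFun_injective : Function.Injective (toFun : OperatorSystemState E → E →L[ℂ] ℂ) := by
  rintro ⟨f, _, _⟩ ⟨g, _, _⟩ h
  simpa using h

theorem norm_apply_le (φ : OperatorSystemState E) (T : E) : ‖φ.toFun T‖ ≤ ‖T‖ := by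
  simpa [φ.norm_eq_one] using φ.toFun.le_opNorm T

/-- A positive functional attains its norm at the unit: `1 = ‖φ‖ ≤ φ(1) ≤ ‖1‖ ≤ 1`. -/
theorem apply_one (h1 : 1 ∈ E) (hs : ∀ T ∈ E, star T ∈ E) (φ : OperatorSystemState E) :
    φ.toFun ⟨1, h1⟩ = 1 := by
  have h0 := Complex.nonneg_iff.1 (φ.nonneg ⟨1, h1⟩ ContinuousLinearMap.isPositive_one)
  have h2 : 1 ≤ (φ.toFun ⟨1, h1⟩).re := by
    rw [← φ.norm_eq_one]
    exact φ.toFun.opNorm_le_bound h0.1 (norm_le_of_positive h1 hs _ φ.nonneg)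
  have h3 : (φ.toFun ⟨1, h1⟩).re ≤ 1 := by
    refine (Complex.re_le_norm _).trans ((φ.norm_apply_le _).trans ?_)
    exact ContinuousLinearMap.norm_id_le
  apply Complex.ext
  · simpa using le_antisymm h3 h2
  · simpa using h0.2.symm

theorem norm_eq_one_of_apply_one [Nontrivial H] (h1 : 1 ∈ E) (hs : ∀ T ∈ E, star T ∈ E)
    (φ : E →L[ℂ] ℂ) (hφ : ∀ T : E, (T : H →L[ℂ] H).IsPositive → 0 ≤ φ T)
    (h : φ ⟨1, h1⟩ = 1) : ‖φ‖ = 1 := by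
  apply le_antisymm
  · refine φ.opNorm_le_bound zero_le_one fun T => ?_
    have := norm_le_of_positive h1 hs φ hφ T
    rwa [h, Complex.one_re] at this
  · have := φ.le_opNorm ⟨1, h1⟩
    rw [h, norm_one, show ‖(⟨1, h1⟩ : E)‖ = ‖(1 : H →L[ℂ] H)‖ from rfl, norm_one,
      mul_one] at this
    exact this

/-- A unital positive functional is a state. -/
def ofUnital [Nontrivial H] (h1 : 1 ∈ E) (hs : ∀ T ∈ E, star T ∈ E)
    (φ : E →L[ℂ] ℂ) (hφ : ∀ T : E, (T : H →L[ℂ] H).IsPositive → 0 ≤ φ T)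
    (h : φ ⟨1, h1⟩ = 1) : OperatorSystemState E :=
  ⟨φ, hφ, norm_eq_one_of_apply_one h1 hs φ hφ h⟩

end OperatorSystemState

/-! ### Non-emptiness and weak-* compactness of the state space -/

namespace OperatorSystemSpectralTriple

variable {H : Type*} [NormedAddCommGroup H] [InnerProductSpace ℂ H] [CompleteSpace H]
  (𝒯 : OperatorSystemSpectralTriple H)

theorem nonempty_state [Nontrivial H] : Nonempty 𝒯.State := by
  obtain ⟨v, hv⟩ := exists_norm_eq H zero_le_one
  refine ⟨.ofUnital 𝒯.one_mem 𝒯.star_mem (((innerSL ℂ v).comp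
    (ContinuousLinearMap.apply ℂ H v)).comp 𝒯.E.subtypeL) (fun T hT => ?_) ?_⟩
  · exact hT.inner_nonneg_right v
  · simp [hv]

/-- Banach–Alaoglu. The unit sphere need not be weak-* closed, but for positive functionals norm one
is equivalent to `φ(1) = 1`, and positivity and unitality are closed conditions. -/
theorem isCompact_univ_weakStar [Nontrivial H] :
    @CompactSpace 𝒯.State 𝒯.weakStarTopology := by
  let _ : TopologicalSpace 𝒯.State := 𝒯.weakStarTopology
  have hind : IsInducing (fun φ : 𝒯.State => StrongDual.toWeakDual φ.toFun) := ⟨rfl⟩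
  refine ⟨hind.isCompact_iff.2 ?_⟩
  have hball := WeakDual.isCompact_closedBall (𝕜 := ℂ) (0 : StrongDual ℂ 𝒯.E) 1
  let K : Set (WeakDual ℂ 𝒯.E) := {φ | (∀ T : 𝒯.E, (T : H →L[ℂ] H).IsPositive → 0 ≤ φ T) ∧
    φ ⟨1, 𝒯.one_mem⟩ = 1}
  have hK : IsClosed K := by
    refine IsClosed.and ?_ (isClosed_eq (WeakDual.eval_continuous _) continuous_const)
    simp only [Set.ofPred_forall]
    exact isClosed_iInter fun T => isClosed_iInter fun _ =>
      isClosed_le continuous_const (WeakDual.eval_continuous T)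
  convert hball.inter_right hK
  ext φ
  constructor
  · rintro ⟨φ, -, rfl⟩
    refine ⟨?_, φ.nonneg, φ.apply_one 𝒯.one_mem 𝒯.star_mem⟩
    simpa using φ.norm_eq_one.le
  · rintro ⟨-, h1, h2⟩
    exact ⟨.ofUnital 𝒯.one_mem 𝒯.star_mem (WeakDual.toStrongDual φ) h1 h2, trivial, rfl⟩

end OperatorSystemSpectralTriple

namespace CircleTriple

/-! ### Multiplication operators -/

theorem mulOp_mul (f g : C(S1, ℂ)) : mulOp (f * g) = mulOp f * mulOp g := by
  ext1 ξ
  apply Lp.ext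
  filter_upwards [coeFn_mulOp (f * g) ξ, coeFn_mulOp f (mulOp g ξ), coeFn_mulOp g ξ]
    with x h1 h2 h3
  rw [mul_apply_eq_comp, h1, h2, h3, ContinuousMap.mul_apply, mul_assoc]

/-- The representation of `C(S¹)` on `L²(S¹)` as a homomorphism of `C*`-algebras. -/
noncomputable def mulHom : C(S1, ℂ) →⋆ₐ[ℂ] (L2 →L[ℂ] L2) where
  toFun := mulOp
  map_one' := mulOp_one
  map_mul' := mulOp_mul
  map_zero' := map_zero _
  map_add' := map_add _
  commutes' c := by
    rw [Algebra.algebraMap_eq_smul_one, map_smul, mulOp_one, Algebra.algebraMap_eq_smul_one]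
  map_star' f := (star_mulOp f).symm

theorem mulOp_injective : Function.Injective mulOp := by
  intro f g h
  have : toL2 f = toL2 g := by
    rw [← mul_one f, ← mul_one g, ← mulOp_toL2, ← mulOp_toL2, h]
  exact ContinuousMap.toLp_injective haarAddCircle this

theorem norm_mulOp (f : C(S1, ℂ)) : ‖mulOp f‖ = ‖f‖ :=
  NonUnitalStarAlgHom.norm_map mulHom mulOp_injective f

theorem isPositive_mulOp {f : C(S1, ℂ)} (hf : ∀ x, 0 ≤ f x) : (mulOp f).IsPositive := by
  rw [← ContinuousLinearMap.nonneg_iff_isPositive]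
  exact map_nonneg mulHom (ContinuousMap.le_def.2 hf)

theorem norm_toL2_le (f : C(S1, ℂ)) : ‖toL2 f‖ ≤ ‖f‖ := by
  have h1 : toL2 f = mulOp f (toL2 1) := by rw [mulOp_toL2, mul_one]
  have h2 : ‖toL2 1‖ = 1 := by
    have := (fourierBasis (T := 2 * π)).orthonormal.1 0
    rw [fourierBasis_apply] at this
    rwa [show (fourier 0 : C(S1, ℂ)) = 1 from ContinuousMap.ext fun x => fourier_zero] at this
  have := (mulOp f).le_opNorm (toL2 1)
  rwa [← h1, h2, mul_one, norm_mulOp] at this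

theorem inner_fourier (j k : ℤ) :
    ⟪toL2 (fourier j), toL2 (fourier k)⟫_ℂ = if j = k then 1 else 0 := by
  rw [← fourierBasis_apply, ← fourierBasis_apply]
  exact orthonormal_iff_ite.1 (fourierBasis (T := 2 * π)).orthonormal j k

instance : Nontrivial L2 :=
  ⟨toL2 (fourier 0), 0, fun h => by simpa [h] using inner_fourier 0 0⟩

end CircleTriple

namespace CircleTriple

/-! ### Derivatives and commutators -/

theorem IsDeriv.sum {ι : Type*} {s : Finset ι} {f f' : ι → C(S1, ℂ)}
    (h : ∀ i ∈ s, IsDeriv (f i) (f' i)) : IsDeriv (∑ i ∈ s, f i) (∑ i ∈ s, f' i) := by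
  intro t
  simp only [ContinuousMap.sum_apply]
  exact HasDerivAt.fun_sum fun i hi => h i hi t

theorem IsDeriv.smul {f f' : C(S1, ℂ)} (h : IsDeriv f f') (c : ℂ) : IsDeriv (c • f) (c • f') :=
  fun t => (h t).const_smul c

theorem exists_real_rep (x : S1) : ∃ t : ℝ, |t| ≤ π ∧ (t : S1) = x := by
  have h : x ∈ ((↑) : ℝ → S1) '' Set.Icc (-π) (-π + 2 * π) := by
    rw [AddCircle.coe_image_Icc_eq]; trivial
  obtain ⟨t, ht, rfl⟩ := h
  exact ⟨t, abs_le.2 ⟨ht.1, by linarith [ht.2]⟩, rfl⟩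

/-- The chord has length `2|sin(t/2)|`, and Jordan's inequality `sin u ≥ 2u/π` on `[0, π/2]` gives
the constant `π/2`. -/
theorem abs_le_chord {t : ℝ} (ht : |t| ≤ π) : |t| ≤ π / 2 * ‖(fourier 1 (t : S1) : ℂ) - 1‖ := by
  have h1 : (fourier 1 (t : S1) : ℂ) = Complex.exp (Complex.I * t) := by
    rw [fourier_coe_apply]
    congr 1
    have : (π : ℂ) ≠ 0 := by exact_mod_cast Real.pi_ne_zero
    push_cast
    field_simp
  rw [h1, Complex.norm_exp_I_mul_ofReal_sub_one, Real.norm_eq_abs, abs_mul, abs_two]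
  have h2 : Real.sin (|t| / 2) ≤ |Real.sin (t / 2)| := by
    rcases abs_cases t with ⟨h, -⟩ | ⟨h, -⟩ <;> rw [h]
    · exact le_abs_self _
    · rw [neg_div, Real.sin_neg]
      exact neg_le_abs _
  have h3 := Real.mul_le_sin (x := |t| / 2) (by positivity) (by linarith)
  have h4 := h3.trans h2
  have := Real.pi_pos
  calc |t| = π * (2 / π * (|t| / 2)) := by field_simp
    _ ≤ π * |Real.sin (t / 2)| := by gcongr
    _ = _ := by ring

/-- A differentiable function on the circle is Lipschitz with respect to the chordal distance. -/
theorem IsDeriv.norm_sub_le {f f' : C(S1, ℂ)} (h : IsDeriv f f') (x y : S1) :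
    ‖f x - f y‖ ≤ π / 2 * ‖f'‖ * ‖(fourier 1 x : ℂ) - fourier 1 y‖ := by
  obtain ⟨b, rfl⟩ := QuotientAddGroup.mk_surjective y
  -- The mean value inequality is applied along the shorter arc from `y` to `x`, of length `|t| ≤
  -- π`.
  obtain ⟨t, ht, htx⟩ := exists_real_rep (x - (b : S1))
  have hx : x = ((b + t : ℝ) : S1) := by
    rw [AddCircle.coe_add, htx]; abel
  have h1 : ‖f ((b + t : ℝ) : S1) - f (b : S1)‖ ≤ ‖f'‖ * ‖(b + t) - b‖ :=
    Convex.norm_image_sub_le_of_norm_hasDerivWithin_le (s := Set.univ)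
      (f := fun s : ℝ => f (s : S1)) (f' := fun s : ℝ => f' (s : S1))
      (fun s _ => (h s).hasDerivWithinAt) (fun s _ => f'.norm_coe_le_norm _)
      convex_univ trivial trivial
  have h2 : ‖(fourier 1 x : ℂ) - fourier 1 (b : S1)‖ = ‖(fourier 1 (t : S1) : ℂ) - 1‖ := by
    have e : (fourier 1 x : ℂ) - fourier 1 (b : S1) =
        fourier 1 (b : S1) * (fourier 1 (t : S1) - 1) := by
      rw [hx, AddCircle.coe_add, fourier_one, fourier_one, fourier_one, AddCircle.toCircle_add]
      push_cast
      ring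
    rw [e, norm_mul, fourier_one, Circle.norm_coe, one_mul]
  change ‖f x - f (b : S1)‖ ≤ π / 2 * ‖f'‖ * ‖(fourier 1 x : ℂ) - fourier 1 (b : S1)‖
  rw [h2, hx]
  refine h1.trans ?_
  rw [add_sub_cancel_left, Real.norm_eq_abs]
  calc ‖f'‖ * |t| ≤ ‖f'‖ * (π / 2 * ‖(fourier 1 (t : S1) : ℂ) - 1‖) := by
        gcongr
        exact abs_le_chord ht
    _ = _ := by ring

/-- The commutator is multiplication by `-i f'`, so the operator condition `‖[D, T]‖ ≤ 1` becomes a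
sup-norm bound on the derivative. -/
theorem IsDeriv.norm_eq_of_isCommutator {f f' : C(S1, ℂ)} (h : IsDeriv f f') {B : L2 →L[ℂ] L2}
    (hB : IsCommutator dirac (mulOp f) B) : ‖B‖ = ‖f'‖ := by
  rw [hB.unique dense_dirac_domain (isCommutator_dirac h), norm_mulOp, norm_smul]
  simp

/-- Matrix coefficients of a commutator with `D`. -/
theorem inner_commutator {T B : L2 →L[ℂ] L2} (h : IsCommutator dirac T B) (j l : ℤ) :
    ⟪toL2 (fourier j), B (toL2 (fourier l))⟫_ℂ =
      (j - l) * ⟪toL2 (fourier j), T (toL2 (fourier l))⟫_ℂ := by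
  obtain ⟨h1, h2⟩ := exists_dirac_eq (isDeriv_mem_diracGraph (isDeriv_fourier l))
  obtain ⟨h3, h4⟩ := h ⟨_, h1⟩
  have h5 : toL2 (-Complex.I • (Complex.I * l) • fourier l) = (l : ℂ) • toL2 (fourier l) := by
    rw [smul_smul, map_smul]
    congr 1
    linear_combination (-(l : ℂ)) * Complex.I_mul_I
  rw [h2, h5, map_smul] at h4
  rw [← h4, inner_sub_right, inner_smul_right,
    mem_diracGraph_iff.1 (dirac_mem_diracGraph ⟨_, h3⟩) j]
  ring

/-! ### The Fejér map -/

/-- The Dirichlet-type vector `∑_{0 ≤ j < n} e^{ij(t - x)}`, as a function of `t`. -/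
noncomputable def fejerVec (n : ℕ) (x : S1) : C(S1, ℂ) :=
  ∑ j ∈ Finset.range n, (fourier (-j : ℤ) x : ℂ) • (fourier (j : ℤ) : C(S1, ℂ))

/-- The matrix coefficient `⟪e_j, T e_l⟫` as a functional of `T`. -/
noncomputable def matrixCoeff (j l : ℤ) : (L2 →L[ℂ] L2) →L[ℂ] ℂ :=
  (innerSL ℂ (toL2 (fourier j))).comp (ContinuousLinearMap.apply ℂ L2 (toL2 (fourier l)))

theorem matrixCoeff_apply (j l : ℤ) (T : L2 →L[ℂ] L2) :
    matrixCoeff j l T = ⟪toL2 (fourier j), T (toL2 (fourier l))⟫_ℂ := rfl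

/-- The Fejér map, sending an operator `T` to the covariant symbol of its compression to the span
of `e_0, …, e_{n-1}`. -/
noncomputable def fejerSymbol (n : ℕ) : (L2 →L[ℂ] L2) →L[ℂ] C(S1, ℂ) :=
  ∑ j ∈ Finset.range n, ∑ l ∈ Finset.range n,
    ((n : ℂ)⁻¹ • matrixCoeff j l).smulRight (fourier ((j : ℤ) - l) : C(S1, ℂ))

theorem fejerSymbol_eq (n : ℕ) (T : L2 →L[ℂ] L2) :
    fejerSymbol n T = ∑ j ∈ Finset.range n, ∑ l ∈ Finset.range n,
      ((n : ℂ)⁻¹ * matrixCoeff j l T) • (fourier ((j : ℤ) - l) : C(S1, ℂ)) := by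
  simp [fejerSymbol]

/-- Each value of the symbol is an expectation of `T` in a vector of norm `√n`, divided by `n`;
contractivity, unitality and positivity are all read off from this. -/
theorem fejerSymbol_apply (n : ℕ) (T : L2 →L[ℂ] L2) (x : S1) :
    fejerSymbol n T x =
      (n : ℂ)⁻¹ * ⟪toL2 (fejerVec n x), T (toL2 (fejerVec n x))⟫_ℂ := by
  rw [fejerSymbol_eq, fejerVec]
  simp only [map_sum, map_smul, sum_inner, inner_sum, inner_smul_left, inner_smul_right,
    ContinuousMap.sum_apply, ContinuousMap.smul_apply, Finset.mul_sum, matrixCoeff_apply,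
    smul_eq_mul]
  rw [Finset.sum_comm]
  refine Finset.sum_congr rfl fun l _ => Finset.sum_congr rfl fun j _ => ?_
  rw [← fourier_neg, neg_neg, sub_eq_add_neg, fourier_add]
  ring

theorem inner_fejerVec (n : ℕ) (x : S1) :
    ⟪toL2 (fejerVec n x), toL2 (fejerVec n x)⟫_ℂ = n := by
  rw [fejerVec]
  simp only [map_sum, map_smul, sum_inner, inner_sum, inner_smul_left, inner_smul_right,
    inner_fourier, Nat.cast_inj]
  simp only [mul_ite, mul_one, mul_zero, Finset.sum_ite_eq']
  rw [Finset.sum_congr rfl (g := fun _ => (1 : ℂ))]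
  · simp
  · intro j hj
    rw [if_pos hj, ← fourier_neg, ← fourier_add]
    simp

theorem norm_fejerVec (n : ℕ) (x : S1) : ‖toL2 (fejerVec n x)‖ = √n := by
  have h := inner_self_eq_norm_sq_to_K (𝕜 := ℂ) (toL2 (fejerVec n x))
  rw [inner_fejerVec, ← RCLike.ofReal_pow, ← RCLike.ofReal_natCast, RCLike.ofReal_inj] at h
  rw [← Real.sqrt_sq (norm_nonneg (toL2 (fejerVec n x)))]
  congr 1
  exact h.symm

theorem norm_fejerSymbol_le (n : ℕ) (T : L2 →L[ℂ] L2) : ‖fejerSymbol n T‖ ≤ ‖T‖ := by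
  rw [ContinuousMap.norm_le _ (norm_nonneg _)]
  intro x
  rcases n.eq_zero_or_pos with rfl | hn
  · simp [fejerSymbol_apply]
  rw [fejerSymbol_apply, norm_mul, norm_inv, Complex.norm_natCast]
  have h : ‖⟪toL2 (fejerVec n x), T (toL2 (fejerVec n x))⟫_ℂ‖ ≤ n * ‖T‖ := by
    refine (norm_inner_le_norm _ _).trans ?_
    calc _ ≤ ‖toL2 (fejerVec n x)‖ * (‖T‖ * ‖toL2 (fejerVec n x)‖) := by
          gcongr; exact T.le_opNorm _
      _ = (√n * √n) * ‖T‖ := by rw [norm_fejerVec]; ring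
      _ = _ := by rw [Real.mul_self_sqrt (Nat.cast_nonneg n)]
  calc (n : ℝ)⁻¹ * _ ≤ (n : ℝ)⁻¹ * (n * ‖T‖) := by gcongr
    _ = ‖T‖ := by field_simp

theorem fejerSymbol_one {n : ℕ} (hn : n ≠ 0) : fejerSymbol n 1 = 1 := by
  ext x
  rw [fejerSymbol_apply, one_apply_eq_self, inner_fejerVec, ContinuousMap.one_apply,
    inv_mul_cancel₀ (Nat.cast_ne_zero.2 hn)]

theorem isPositive_mulOp_fejerSymbol (n : ℕ) {T : L2 →L[ℂ] L2} (hT : T.IsPositive) :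
    (mulOp (fejerSymbol n T)).IsPositive := by
  refine isPositive_mulOp fun x => ?_
  rw [fejerSymbol_apply]
  refine mul_nonneg ?_ (hT.inner_nonneg_right _)
  rw [inv_nonneg]
  exact Nat.cast_nonneg n

/-- Passing from `T` to `[D, T]` multiplies the `(j, l)` matrix coefficient by `j - l`, and
differentiating `e^{i(j-l)x}` multiplies it by `i(j - l)`. -/
theorem isDeriv_fejerSymbol (n : ℕ) {T B : L2 →L[ℂ] L2} (h : IsCommutator dirac T B) :
    IsDeriv (fejerSymbol n T) (Complex.I • fejerSymbol n B) := by
  simp only [fejerSymbol_eq, Finset.smul_sum]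
  refine IsDeriv.sum fun j _ => IsDeriv.sum fun l _ => ?_
  convert (isDeriv_fourier ((j : ℤ) - l)).smul ((n : ℂ)⁻¹ * matrixCoeff j l T) using 1
  rw [smul_smul, smul_smul, matrixCoeff_apply, matrixCoeff_apply, inner_commutator h]
  congr 1
  push_cast
  ring

theorem isCommutator_fejerSymbol (n : ℕ) {T B : L2 →L[ℂ] L2} (h : IsCommutator dirac T B) :
    IsCommutator dirac (mulOp (fejerSymbol n T)) (mulOp (fejerSymbol n B)) := by
  convert isCommutator_dirac (isDeriv_fejerSymbol n h) using 2
  simp [smul_smul]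

/-- Up to a phase the product is `(u - 1) ∑ u^j = u^n - 1` with `u = e^{i(t-x)}`. The bound does not
depend on `n`. -/
theorem chord_mul_fejerVec (n : ℕ) (x t : S1) :
    ‖(fourier 1 t : ℂ) - fourier 1 x‖ * ‖fejerVec n x t‖ ≤ 2 := by
  obtain ⟨u, hu⟩ : ∃ u : ℂ, u = fourier 1 (t - x) := ⟨_, rfl⟩
  rw [fourier_one] at hu
  have h1 : (fourier 1 t : ℂ) - fourier 1 x = fourier 1 x * (u - 1) := by
    rw [fourier_one, fourier_one, hu, mul_sub, ← Circle.coe_mul, ← AddCircle.toCircle_add]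
    simp
  have h2 : fejerVec n x t = ∑ j ∈ Finset.range n, u ^ j := by
    rw [fejerVec, ContinuousMap.sum_apply]
    refine Finset.sum_congr rfl fun j _ => ?_
    rw [ContinuousMap.smul_apply, smul_eq_mul, fourier_apply, fourier_apply, ← Circle.coe_mul,
      ← AddCircle.toCircle_add, hu, ← Circle.coe_pow, ← AddCircle.toCircle_nsmul]
    congr 2
    simp [smul_sub]
    abel
  have hu1 : ‖u‖ = 1 := hu ▸ Circle.norm_coe _
  rw [h1, h2, norm_mul, mul_assoc, ← norm_mul, mul_geom_sum, fourier_one, Circle.norm_coe,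
    one_mul]
  refine (norm_sub_le _ _).trans ?_
  rw [norm_pow, hu1]
  norm_num

/-- The error at `x` is `n⁻¹⟪v_x, (f - f(x)) v_x⟫`. The chordal Lipschitz bound on `f` cancels the
peak of `v_x` at `x`, so `(f - f(x)) v_x` is at most `π‖f'‖` in sup norm; Cauchy–Schwarz with `‖v_x‖
= √n` finishes. This avoids computing moments of the Fejér kernel. -/
theorem norm_fejerSymbol_mulOp_sub_le {n : ℕ} (hn : n ≠ 0) {f f' : C(S1, ℂ)} (h : IsDeriv f f') :
    ‖fejerSymbol n (mulOp f) - f‖ ≤ π * ‖f'‖ / √n := by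
  have hn' : (0 : ℝ) < n := by exact_mod_cast Nat.pos_of_ne_zero hn
  rw [ContinuousMap.norm_le _ (by positivity)]
  intro x
  set g : C(S1, ℂ) := (f - f x • 1) * fejerVec n x with hg
  have hgn : ‖g‖ ≤ π * ‖f'‖ := by
    rw [ContinuousMap.norm_le _ (by positivity)]
    intro t
    rw [hg, ContinuousMap.mul_apply, norm_mul]
    calc _ ≤ (π / 2 * ‖f'‖ * ‖(fourier 1 t : ℂ) - fourier 1 x‖) * ‖fejerVec n x t‖ := by
          gcongr
          simpa using h.norm_sub_le t x
      _ = (π / 2 * ‖f'‖) * (‖(fourier 1 t : ℂ) - fourier 1 x‖ * ‖fejerVec n x t‖) := by ring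
      _ ≤ (π / 2 * ‖f'‖) * 2 := by
          gcongr
          exact chord_mul_fejerVec n x t
      _ = _ := by ring
  have e : (fejerSymbol n (mulOp f) - f) x = (n : ℂ)⁻¹ * ⟪toL2 (fejerVec n x), toL2 g⟫_ℂ := by
    have : toL2 g = mulOp f (toL2 (fejerVec n x)) - f x • toL2 (fejerVec n x) := by
      rw [hg, sub_mul, map_sub, mulOp_toL2, smul_mul_assoc, one_mul, map_smul]
    rw [this, inner_sub_right, inner_smul_right, inner_fejerVec, mul_sub, ← fejerSymbol_apply]
    have : (n : ℂ) ≠ 0 := Nat.cast_ne_zero.2 hn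
    rw [ContinuousMap.sub_apply]
    field_simp
  rw [e, norm_mul, norm_inv, Complex.norm_natCast]
  calc (n : ℝ)⁻¹ * _ ≤ (n : ℝ)⁻¹ * (√n * (π * ‖f'‖)) := by
        gcongr
        refine (norm_inner_le_norm _ _).trans ?_
        rw [norm_fejerVec]
        gcongr
        exact (norm_toL2_le g).trans hgn
    _ = _ := by
      have h2 := Real.mul_self_sqrt hn'.le
      have : 0 < √(n : ℝ) := Real.sqrt_pos.2 hn'
      rw [inv_mul_eq_div, div_eq_div_iff hn'.ne' this.ne']
      linear_combination (π * ‖f'‖) * h2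

end CircleTriple

/-- A compact topology finer than a Hausdorff topology is equal to it. -/
theorem topology_eq_of_compact_of_t2 {X : Type*} {t t' : TopologicalSpace X} (hle : t ≤ t')
    (hc : @CompactSpace X t) (ht : @T2Space X t') : t = t' := by
  refine le_antisymm hle ?_
  rw [TopologicalSpace.le_def]
  intro s hs
  rw [← @isClosed_compl_iff _ t] at hs
  rw [← @isClosed_compl_iff _ t']
  have h0 := @IsCompact.of_isClosed_subset X t _ _ (@isCompact_univ X t hc) hs (Set.subset_univ _)
  have h1 := @IsCompact.image X X t t' _ id h0 (continuous_id_iff_le.2 hle)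
  rw [Set.image_id] at h1
  exact h1.isClosed

namespace OperatorSystemSpectralTriple

variable {H : Type*} [NormedAddCommGroup H] [InnerProductSpace ℂ H] [CompleteSpace H]
  {𝒯 : OperatorSystemSpectralTriple H}

/-! ### The distance on the state space -/

theorem lipNorm_eq {T : 𝒯.smooth} {B : H →L[ℂ] H} (hB : IsCommutator 𝒯.D T B) :
    𝒯.lipNorm T = ‖B‖ := by
  rw [lipNorm, (𝒯.isCommutator_commutator T).unique 𝒯.isSelfAdjoint.dense_domain hB]

theorem lipNorm_smul (c : ℂ) (T : 𝒯.smooth) : 𝒯.lipNorm (c • T) = ‖c‖ * 𝒯.lipNorm T := by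
  have h : IsCommutator 𝒯.D (c • T : 𝒯.smooth) (c • 𝒯.commutator T) := by
    intro ξ
    obtain ⟨h1, h2⟩ := 𝒯.isCommutator_commutator T ξ
    refine ⟨𝒯.D.domain.smul_mem c h1, ?_⟩
    change 𝒯.D (c • ⟨_, h1⟩) - c • (T : H →L[ℂ] H) (𝒯.D ξ) = c • 𝒯.commutator T ξ
    rw [LinearPMap.map_smul, ← smul_sub, h2]
  rw [lipNorm_eq h, norm_smul, lipNorm]

theorem enorm_sub_le_stateEDist (φ ψ : 𝒯.State) {T : 𝒯.smooth} (hT : 𝒯.lipNorm T ≤ 1) :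
    ‖φ.toFun (Submodule.inclusion 𝒯.smooth_le T) -
      ψ.toFun (Submodule.inclusion 𝒯.smooth_le T)‖ₑ ≤ 𝒯.stateEDist φ ψ :=
  le_iSup₂ (f := fun (T : 𝒯.smooth) (_ : 𝒯.lipNorm T ≤ 1) =>
    ‖φ.toFun (Submodule.inclusion 𝒯.smooth_le T) -
      ψ.toFun (Submodule.inclusion 𝒯.smooth_le T)‖ₑ) T hT

theorem stateEDist_le_ofReal_iff {φ ψ : 𝒯.State} {C : ℝ} (hC : 0 ≤ C) :
    𝒯.stateEDist φ ψ ≤ ENNReal.ofReal C ↔ ∀ T : 𝒯.smooth, 𝒯.lipNorm T ≤ 1 →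
      ‖φ.toFun (Submodule.inclusion 𝒯.smooth_le T) -
        ψ.toFun (Submodule.inclusion 𝒯.smooth_le T)‖ ≤ C := by
  rw [stateEDist, iSup₂_le_iff]
  simp only [← ofReal_norm, ENNReal.ofReal_le_ofReal_iff hC]

theorem stateEDist_self (φ : 𝒯.State) : 𝒯.stateEDist φ φ = 0 := by
  simp [stateEDist]

theorem stateEDist_comm (φ ψ : 𝒯.State) : 𝒯.stateEDist φ ψ = 𝒯.stateEDist ψ φ := by
  simp only [stateEDist, ← enorm_neg (φ.toFun _ - ψ.toFun _), neg_sub]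

theorem stateEDist_triangle (φ ψ χ : 𝒯.State) :
    𝒯.stateEDist φ χ ≤ 𝒯.stateEDist φ ψ + 𝒯.stateEDist ψ χ := by
  refine iSup₂_le fun T hT => ?_
  rw [← sub_add_sub_cancel _ (ψ.toFun (Submodule.inclusion 𝒯.smooth_le T))]
  exact (enorm_add_le _ _).trans
    (add_le_add (enorm_sub_le_stateEDist φ ψ hT) (enorm_sub_le_stateEDist ψ χ hT))

theorem eq_of_stateEDist_eq_zero {φ ψ : 𝒯.State} (h : 𝒯.stateEDist φ ψ = 0) : φ = ψ := by
  have key : ∀ T : 𝒯.smooth, φ.toFun (Submodule.inclusion 𝒯.smooth_le T) =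
      ψ.toFun (Submodule.inclusion 𝒯.smooth_le T) := by
    intro T
    have hc : 0 < 𝒯.lipNorm T + 1 := by
      have : 0 ≤ 𝒯.lipNorm T := norm_nonneg _
      linarith
    -- `T` is scaled into the Lipschitz ball; the `+ 1` covers the case of seminorm zero.
    obtain ⟨c, hcdef⟩ : ∃ c : ℂ, c = ((𝒯.lipNorm T + 1)⁻¹ : ℝ) := ⟨_, rfl⟩
    have hT : 𝒯.lipNorm (c • T) ≤ 1 := by
      rw [lipNorm_smul, hcdef, Complex.norm_real, Real.norm_of_nonneg (by positivity),
        inv_mul_le_one₀ hc]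
      linarith
    have h1 := enorm_sub_le_stateEDist φ ψ hT
    rw [h, nonpos_iff_eq_zero, enorm_eq_zero, map_smul, map_smul, map_smul, ← smul_sub,
      smul_eq_zero] at h1
    refine sub_eq_zero.1 (h1.resolve_left ?_)
    rw [hcdef]
    exact Complex.ofReal_ne_zero.2 (inv_ne_zero hc.ne')
  apply OperatorSystemState.toFun_injective
  ext T
  rw [← sub_eq_zero, ← norm_eq_zero]
  refine le_antisymm (le_of_forall_pos_le_add fun ε hε => ?_) (norm_nonneg _)
  -- The states agree on the dense subspace, and each has norm one, so an approximation within `ε /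
  -- 2` costs `ε` in total.
  obtain ⟨S, hS, hST⟩ := Metric.mem_closure_iff.1 (𝒯.le_closure T.2) (ε / 2) (half_pos hε)
  set S' : 𝒯.E := Submodule.inclusion 𝒯.smooth_le ⟨S, hS⟩ with hS'
  have e : φ.toFun T - ψ.toFun T = φ.toFun (T - S') - ψ.toFun (T - S') := by
    rw [map_sub, map_sub, hS', key]
    ring
  have hn : ‖T - S'‖ < ε / 2 := by
    rw [dist_eq_norm] at hST
    exact hST
  rw [e]
  linarith [norm_sub_le (φ.toFun (T - S')) (ψ.toFun (T - S')), φ.norm_apply_le (T - S'),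
    ψ.norm_apply_le (T - S')]

/-- The metric on the state space, provided that the distance is finite. -/
noncomputable abbrev stateMetric (hfin : ∀ φ ψ : 𝒯.State, 𝒯.stateEDist φ ψ ≠ ⊤) :
    MetricSpace 𝒯.State :=
  letI : EMetricSpace 𝒯.State :=
    { edist := 𝒯.stateEDist
      edist_self := stateEDist_self
      edist_comm := stateEDist_comm
      edist_triangle := stateEDist_triangle
      eq_of_edist_eq_zero := eq_of_stateEDist_eq_zero }
  EMetricSpace.toMetricSpace hfin

/-- If the distance is finite and weak-* continuous, then it is a metric for the weak-*
topology. -/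
theorem isStateMetric_stateMetric [Nontrivial H]
    (hfin : ∀ φ ψ : 𝒯.State, 𝒯.stateEDist φ ψ ≠ ⊤)
    (hcont : ∀ (φ : 𝒯.State) (ε : ℝ), 0 < ε →
      ∀ᶠ ψ in @nhds _ 𝒯.weakStarTopology φ, 𝒯.stateEDist ψ φ < ENNReal.ofReal ε) :
    𝒯.IsStateMetric (stateMetric hfin) := by
  refine ⟨fun _ _ => rfl, ?_⟩
  let m := stateMetric hfin
  -- Only this direction needs the estimate; the reverse follows because the weak-* topology is
  -- compact and the metric one Hausdorff.
  have hc : @Continuous _ _ 𝒯.weakStarTopology m.toUniformSpace.toTopologicalSpace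
      (id : 𝒯.State → 𝒯.State) := by
    refine (@continuous_iff_continuousAt _ _ 𝒯.weakStarTopology
      m.toUniformSpace.toTopologicalSpace id).2 fun φ => ?_
    refine EMetric.tendsto_nhds.2 fun ε hε => ?_
    obtain ⟨r, hr, hrε⟩ := ENNReal.lt_iff_exists_nnreal_btwn.1 hε
    filter_upwards [hcont φ r (by exact_mod_cast hr)] with ψ hψ
    refine lt_trans ?_ hrε
    rwa [ENNReal.ofReal_coe_nnreal] at hψ
  exact (topology_eq_of_compact_of_t2 (continuous_id_iff_le.1 hc) 𝒯.isCompact_univ_weakStar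
    inferInstance).symm

theorem IsStateMetric.compactSpace [Nontrivial H] [m : MetricSpace 𝒯.State]
    (hm : 𝒯.IsStateMetric m) : CompactSpace 𝒯.State := by
  have := 𝒯.isCompact_univ_weakStar
  rwa [← hm.topology_eq] at this

theorem IsStateMetric.dist_le_iff [m : MetricSpace 𝒯.State] (hm : 𝒯.IsStateMetric m)
    {φ ψ : 𝒯.State} {C : ℝ} (hC : 0 ≤ C) :
    dist φ ψ ≤ C ↔ ∀ T : 𝒯.smooth, 𝒯.lipNorm T ≤ 1 →
      ‖φ.toFun (Submodule.inclusion 𝒯.smooth_le T) -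
        ψ.toFun (Submodule.inclusion 𝒯.smooth_le T)‖ ≤ C := by
  rw [← stateEDist_le_ofReal_iff hC, ← hm.edist_eq, ← ENNReal.ofReal_le_ofReal_iff hC,
    ← edist_dist]
  rfl

theorem IsStateMetric.norm_sub_le [m : MetricSpace 𝒯.State] (hm : 𝒯.IsStateMetric m)
    (φ ψ : 𝒯.State) {T : 𝒯.smooth} (hT : 𝒯.lipNorm T ≤ 1) :
    ‖φ.toFun (Submodule.inclusion 𝒯.smooth_le T) -
      ψ.toFun (Submodule.inclusion 𝒯.smooth_le T)‖ ≤ dist φ ψ :=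
  (hm.dist_le_iff dist_nonneg).1 le_rfl T hT

end OperatorSystemSpectralTriple

namespace CircleTriple

/-! ### Spectral triples of translation invariant spaces of functions on the circle -/

/-- The smooth elements of `𝒯` form a space of multiplication operators by differentiable functions
that contains every character occurring in one of its elements, and its Dirac operator is
`-i d/dx`. -/
structure IsCircular (𝒯 : OperatorSystemSpectralTriple L2) : Prop where
  D_eq : 𝒯.D = dirac
  exists_deriv : ∀ T ∈ 𝒯.smooth, ∃ f f', IsDeriv f f' ∧ mulOp f = T
  fourier_mem : ∀ T ∈ 𝒯.smooth, ∀ j l, matrixCoeff j l T ≠ 0 → mulOp (fourier (j - l)) ∈ 𝒯.smooth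

/-! ### Finiteness and weak-* continuity of the distance -/

namespace IsCircular

variable {𝒯 : OperatorSystemSpectralTriple L2} (h : IsCircular 𝒯)
include h

theorem isCommutator (T : 𝒯.smooth) : IsCommutator dirac T (𝒯.commutator T) := by
  have := 𝒯.isCommutator_commutator T
  rwa [h.D_eq] at this

/-- The Fejér symbol has to be split into characters on which states can be evaluated. A character
may be missing from the system, but then its coefficient vanishes. -/
theorem smul_fourier_mem (n : ℕ) (T : 𝒯.smooth) (j l : ℤ) :
    ((n : ℂ)⁻¹ * matrixCoeff j l T) • mulOp (fourier (j - l)) ∈ 𝒯.smooth := by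
  by_cases hc : matrixCoeff j l T = 0
  · rw [hc, mul_zero, zero_smul]
    exact zero_mem _
  · exact 𝒯.smooth.smul_mem _ (h.fourier_mem T T.2 j l hc)

theorem norm_fejerSymbol_sub_le {n : ℕ} (hn : n ≠ 0) {T : 𝒯.smooth} (hT : 𝒯.lipNorm T ≤ 1) :
    ‖mulOp (fejerSymbol n T) - T‖ ≤ π / √n := by
  obtain ⟨f, f', hf, hfT⟩ := h.exists_deriv T T.2
  have hc := h.isCommutator T
  rw [← hfT] at hc ⊢
  have hf' : ‖f'‖ ≤ 1 := by
    rw [← hf.norm_eq_of_isCommutator hc]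
    exact hT
  rw [← map_sub, norm_mulOp]
  refine (norm_fejerSymbol_mulOp_sub_le hn hf).trans ?_
  have := Real.pi_pos
  gcongr
  nlinarith

/-- The coefficient of `[D, T]` is `j - l` times that of `T`, and `|j - l| ≥ 1`. The commutator says
nothing about the diagonal. -/
theorem norm_matrixCoeff_le {T : 𝒯.smooth} (hT : 𝒯.lipNorm T ≤ 1) {j l : ℤ} (hjl : j ≠ l) :
    ‖matrixCoeff j l T‖ ≤ 1 := by
  have h1 := inner_commutator (h.isCommutator T) j l
  rw [← matrixCoeff_apply, ← matrixCoeff_apply] at h1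
  have h2 : ‖matrixCoeff j l (𝒯.commutator T)‖ ≤ 1 := by
    have hn : ∀ k : ℤ, ‖toL2 (fourier k)‖ = 1 := by
      intro k
      rw [← fourierBasis_apply]
      exact (fourierBasis (T := 2 * π)).orthonormal.1 k
    rw [matrixCoeff_apply]
    refine (norm_inner_le_norm _ _).trans ?_
    rw [hn, one_mul]
    refine ((𝒯.commutator T).le_opNorm _).trans ?_
    rw [hn, mul_one]
    exact hT
  have h3 : (1 : ℝ) ≤ ‖((j : ℂ) - l)‖ := by
    rw [← Int.cast_sub, Complex.norm_intCast]
    exact_mod_cast Int.one_le_abs (sub_ne_zero.2 hjl)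
  rw [h1, norm_mul] at h2
  nlinarith [norm_nonneg (matrixCoeff j l (T : L2 →L[ℂ] L2))]

open Classical in
omit h in
/-- The difference of two states at the character `e^{ikx}`, if it belongs to the operator
system. -/
noncomputable def charDiff (φ ψ : 𝒯.State) (k : ℤ) : ℝ :=
  if hk : mulOp (fourier k) ∈ 𝒯.E then ‖φ.toFun ⟨_, hk⟩ - ψ.toFun ⟨_, hk⟩‖ else 0

/-- Replacing `T` by its Fejér symbol costs `π/√n` for each state. What remains is a finite sum of
characters with coefficients bounded independently of `T`, so the estimate is uniform over the
Lipschitz ball. -/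
theorem norm_sub_le (φ ψ : 𝒯.State) {n : ℕ} (hn : n ≠ 0) {T : 𝒯.smooth}
    (hT : 𝒯.lipNorm T ≤ 1) :
    ‖φ.toFun (Submodule.inclusion 𝒯.smooth_le T) - ψ.toFun (Submodule.inclusion 𝒯.smooth_le T)‖ ≤
      2 * (π / √n) + ∑ j ∈ Finset.range n, ∑ l ∈ Finset.range n,
        (n : ℝ)⁻¹ * charDiff φ ψ ((j : ℤ) - l) := by
  set t : 𝒯.E := Submodule.inclusion 𝒯.smooth_le T
  let term : ℕ → ℕ → 𝒯.E := fun j l => ⟨_, 𝒯.smooth_le (h.smul_fourier_mem n T j l)⟩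
  have hs : ((∑ j ∈ Finset.range n, ∑ l ∈ Finset.range n, term j l : 𝒯.E) : L2 →L[ℂ] L2) =
      mulOp (fejerSymbol n T) := by
    simp [fejerSymbol_eq, term]
  set s : 𝒯.E := ∑ j ∈ Finset.range n, ∑ l ∈ Finset.range n, term j l with hsdef
  have hst : ‖t - s‖ ≤ π / √n := by
    rw [← norm_neg, neg_sub]
    have := h.norm_fejerSymbol_sub_le hn hT
    rw [← hs] at this
    exact this
  have hterm : ∀ j l, ‖φ.toFun (term j l) - ψ.toFun (term j l)‖ ≤
      (n : ℝ)⁻¹ * charDiff φ ψ ((j : ℤ) - l) := by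
    intro j l
    have h0 : 0 ≤ (n : ℝ)⁻¹ * charDiff φ ψ ((j : ℤ) - l) := by
      rw [charDiff]
      split_ifs <;> positivity
    by_cases hc : matrixCoeff j l T = 0
    · have : term j l = 0 := by
        apply Subtype.ext
        simp [term, hc]
      rw [this, map_zero, map_zero, sub_zero, norm_zero]
      exact h0
    have hk : mulOp (fourier ((j : ℤ) - l)) ∈ 𝒯.E := 𝒯.smooth_le (h.fourier_mem T T.2 j l hc)
    have e : term j l = ((n : ℂ)⁻¹ * matrixCoeff j l T) • (⟨_, hk⟩ : 𝒯.E) := rfl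
    rw [e, map_smul, map_smul, ← smul_sub, norm_smul, charDiff, dif_pos hk, norm_mul, norm_inv,
      Complex.norm_natCast]
    by_cases hjl : j = l
    · have h1 : (⟨_, hk⟩ : 𝒯.E) = ⟨1, 𝒯.one_mem⟩ := by
        apply Subtype.ext
        change mulOp (fourier ((j : ℤ) - l)) = 1
        rw [hjl, sub_self, ← mulOp_one]
        congr 1
        ext x
        simp
      rw [h1, φ.apply_one 𝒯.one_mem 𝒯.star_mem, ψ.apply_one 𝒯.one_mem 𝒯.star_mem]
      simp
    · gcongr
      have := h.norm_matrixCoeff_le hT (j := j) (l := l) (by exact_mod_cast hjl)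
      exact mul_le_of_le_one_right (by positivity) this
  have e : φ.toFun t - ψ.toFun t = φ.toFun (t - s) - ψ.toFun (t - s) +
      ∑ j ∈ Finset.range n, ∑ l ∈ Finset.range n,
        (φ.toFun (term j l) - ψ.toFun (term j l)) := by
    simp only [Finset.sum_sub_distrib, ← map_sum, ← hsdef]
    rw [map_sub, map_sub]
    ring
  rw [e]
  refine (norm_add_le _ _).trans (add_le_add ?_ ?_)
  · linarith [_root_.norm_sub_le (φ.toFun (t - s)) (ψ.toFun (t - s)), φ.norm_apply_le (t - s),
      ψ.norm_apply_le (t - s)]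
  · exact (norm_sum_le _ _).trans (Finset.sum_le_sum fun j _ => (norm_sum_le _ _).trans
      (Finset.sum_le_sum fun l _ => hterm j l))

omit h in
theorem charDiff_nonneg (φ ψ : 𝒯.State) (k : ℤ) : 0 ≤ charDiff φ ψ k := by
  rw [charDiff]
  split_ifs <;> positivity

theorem stateEDist_le (φ ψ : 𝒯.State) {n : ℕ} (hn : n ≠ 0) :
    𝒯.stateEDist φ ψ ≤ ENNReal.ofReal (2 * (π / √n) +
      ∑ j ∈ Finset.range n, ∑ l ∈ Finset.range n,
        (n : ℝ)⁻¹ * charDiff φ ψ ((j : ℤ) - l)) := by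
  have := Real.pi_pos
  refine (OperatorSystemSpectralTriple.stateEDist_le_ofReal_iff ?_).2
    fun T hT => h.norm_sub_le φ ψ hn hT
  have : 0 ≤ ∑ j ∈ Finset.range n, ∑ l ∈ Finset.range n,
      (n : ℝ)⁻¹ * charDiff φ ψ ((j : ℤ) - l) :=
    Finset.sum_nonneg fun j _ => Finset.sum_nonneg fun l _ =>
      mul_nonneg (by positivity) (charDiff_nonneg φ ψ _)
  positivity

theorem stateEDist_ne_top (φ ψ : 𝒯.State) : 𝒯.stateEDist φ ψ ≠ ⊤ :=
  ne_top_of_le_ne_top ENNReal.ofReal_ne_top (h.stateEDist_le φ ψ one_ne_zero)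

omit h in
theorem tendsto_charDiff (φ : 𝒯.State) (k : ℤ) :
    Tendsto (fun ψ => charDiff ψ φ k) (@nhds _ 𝒯.weakStarTopology φ) (𝓝 0) := by
  let _ := 𝒯.weakStarTopology
  simp only [charDiff]
  split_ifs with hk
  · have h1 : Continuous fun ψ : 𝒯.State => ψ.toFun ⟨_, hk⟩ :=
      (WeakDual.eval_continuous (⟨_, hk⟩ : 𝒯.E)).comp continuous_induced_dom
    have h2 := ((h1.tendsto φ).sub_const (φ.toFun ⟨_, hk⟩)).norm
    rwa [sub_self, norm_zero] at h2
  · exact tendsto_const_nhds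

/-- First `n` is fixed so that the approximation error is below `ε`; then only finitely many
characters remain, and the states converge on each of them. -/
theorem eventually_stateEDist_lt (φ : 𝒯.State) (ε : ℝ) (hε : 0 < ε) :
    ∀ᶠ ψ in @nhds _ 𝒯.weakStarTopology φ, 𝒯.stateEDist ψ φ < ENNReal.ofReal ε := by
  obtain ⟨n, hn, hnε⟩ : ∃ n : ℕ, n ≠ 0 ∧ 2 * (π / √n) < ε := by
    have h1 : Tendsto (fun n : ℕ => 2 * (π / √(n : ℝ))) atTop (𝓝 (2 * 0)) :=
      (Tendsto.div_atTop tendsto_const_nhds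
        (Real.tendsto_sqrt_atTop.comp tendsto_natCast_atTop_atTop)).const_mul 2
    rw [mul_zero] at h1
    exact ((eventually_ne_atTop 0).and (h1.eventually_lt_const hε)).exists
  have h2 : Tendsto (fun ψ => 2 * (π / √n) + ∑ j ∈ Finset.range n, ∑ l ∈ Finset.range n,
      (n : ℝ)⁻¹ * charDiff ψ φ ((j : ℤ) - l)) (@nhds _ 𝒯.weakStarTopology φ)
      (𝓝 (2 * (π / √n) + ∑ j ∈ Finset.range n, ∑ l ∈ Finset.range n, (n : ℝ)⁻¹ * 0)) :=
    tendsto_const_nhds.add (tendsto_finsetSum _ fun j _ => tendsto_finsetSum _ fun l _ =>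
      (tendsto_charDiff φ _).const_mul _)
  simp only [mul_zero, Finset.sum_const_zero, add_zero] at h2
  filter_upwards [h2.eventually_lt_const hnε] with ψ hψ
  exact (h.stateEDist_le ψ φ hn).trans_lt ((ENNReal.ofReal_lt_ofReal_iff hε).2 hψ)

theorem isStateMetric : 𝒯.IsStateMetric
    (OperatorSystemSpectralTriple.stateMetric h.stateEDist_ne_top) :=
  OperatorSystemSpectralTriple.isStateMetric_stateMetric _ h.eventually_stateEDist_lt

end IsCircular

/-! ### The circle and the Fejér–Riesz triples are circular -/

theorem isCircular_circle : IsCircular circle where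
  D_eq := rfl
  exists_deriv := by
    rintro _ ⟨f, hf, rfl⟩
    obtain ⟨f', h⟩ := exists_isDeriv hf
    exact ⟨f, f', h, rfl⟩
  fourier_mem _ _ j l _ := ⟨_, fourier_mem_smooth (j - l), rfl⟩

theorem fourier_mem_fejerRiesz {n : ℕ+} {k : ℤ} (hk : |k| < n) :
    (fourier k : C(S1, ℂ)) ∈ fejerRiesz n := by
  rw [fejerRiesz_eq_span]
  exact Submodule.subset_span ⟨k, abs_lt.1 hk, rfl⟩

/-- Multiplication by `e^{ikx}` shifts the Fourier basis by `k`, so these operators have matrices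
banded in `|j - l| < n`. -/
theorem matrixCoeff_mulOp_fejerRiesz {n : ℕ+} {f : C(S1, ℂ)} (hf : f ∈ fejerRiesz n) {j l : ℤ}
    (hjl : (n : ℤ) ≤ |j - l|) : matrixCoeff j l (mulOp f) = 0 := by
  rw [fejerRiesz_eq_span] at hf
  induction hf using Submodule.span_induction with
  | mem x hx =>
    obtain ⟨k, hk, rfl⟩ := hx
    have e : (fourier k * fourier l : C(S1, ℂ)) = fourier (k + l) := by
      ext x
      exact fourier_add.symm
    rw [matrixCoeff_apply, mulOp_toL2, e, inner_fourier, if_neg]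
    rintro rfl
    rw [add_sub_cancel_right] at hjl
    exact absurd (abs_lt.2 hk) (not_lt.2 hjl)
  | zero => simp
  | add x y _ _ hx hy => rw [map_add, map_add, hx, hy, add_zero]
  | smul c x _ hx => rw [map_smul, map_smul, hx, smul_zero]

theorem isCircular_fejerRieszTriple (n : ℕ+) : IsCircular (fejerRieszTriple n) where
  D_eq := rfl
  exists_deriv := by
    rintro _ ⟨f, hf, rfl⟩
    obtain ⟨f', h⟩ := exists_isDeriv (fejerRiesz_le_smooth n hf)
    exact ⟨f, f', h, rfl⟩
  fourier_mem := by
    rintro _ ⟨f, hf, rfl⟩ j l hjl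
    refine ⟨_, fourier_mem_fejerRiesz (not_le.1 fun hle => hjl ?_), rfl⟩
    exact matrixCoeff_mulOp_fejerRiesz hf hle

/-! ### Comparison of the state spaces -/

theorem fejerRieszTriple_smooth_le (n : ℕ+) : (fejerRieszTriple n).smooth ≤ circle.smooth :=
  Submodule.map_mono (fejerRiesz_le_smooth n)

theorem fejerRieszTriple_E_le (n : ℕ+) : (fejerRieszTriple n).E ≤ circle.E := by
  rintro _ ⟨f, -, rfl⟩
  exact ⟨f, rfl⟩

theorem mulOp_fejerSymbol_mem_E (n : ℕ+) (T : L2 →L[ℂ] L2) :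
    mulOp (fejerSymbol n T) ∈ (fejerRieszTriple n).E := by
  refine ⟨_, ?_, rfl⟩
  rw [fejerSymbol_eq]
  refine Submodule.sum_mem _ fun j hj => Submodule.sum_mem _ fun l hl =>
    Submodule.smul_mem _ _ (fourier_mem_fejerRiesz ?_)
  rw [Finset.mem_range] at hj hl
  rw [abs_lt]
  constructor <;> omega

/-- Restriction of states of `C(S¹)` to the Fejér–Riesz operator system. -/
noncomputable def restrictState (n : ℕ+) (φ : circle.State) : (fejerRieszTriple n).State :=
  .ofUnital (fejerRieszTriple n).one_mem (fejerRieszTriple n).star_mem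
    (φ.toFun.comp ((fejerRieszTriple n).E.subtypeL.codRestrict circle.E
      fun T => fejerRieszTriple_E_le n T.2))
    (fun T hT => φ.nonneg ⟨T, fejerRieszTriple_E_le n T.2⟩ hT)
    (φ.apply_one circle.one_mem circle.star_mem)

/-- Composition of states of the Fejér–Riesz operator system with the Fejér map. -/
noncomputable def liftState (n : ℕ+) (φ : (fejerRieszTriple n).State) : circle.State :=
  .ofUnital circle.one_mem circle.star_mem
    (φ.toFun.comp (((mulOp.comp (fejerSymbol n)).comp circle.E.subtypeL).codRestrict
      (fejerRieszTriple n).E fun T => mulOp_fejerSymbol_mem_E n T))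
    (fun T hT => φ.nonneg ⟨_, mulOp_fejerSymbol_mem_E n T⟩ (isPositive_mulOp_fejerSymbol n hT))
    (by
      rw [← φ.apply_one (fejerRieszTriple n).one_mem (fejerRieszTriple n).star_mem]
      change φ.toFun ⟨mulOp (fejerSymbol n 1), _⟩ = _
      congr 2
      rw [fejerSymbol_one n.ne_zero, mulOp_one])

/-! ### Lipschitz estimates and the Gromov–Hausdorff bound -/

section Dist

variable {n : ℕ+} [mₙ : MetricSpace (fejerRieszTriple n).State] [m : MetricSpace circle.State]
  (hn : (fejerRieszTriple n).IsStateMetric mₙ) (h : circle.IsStateMetric m)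
include hn h

/-- The commutator does not depend on the system, so the smaller system only offers fewer test
elements. -/
theorem dist_restrictState_le (φ ψ : circle.State) :
    dist (restrictState n φ) (restrictState n ψ) ≤ dist φ ψ := by
  refine (hn.dist_le_iff dist_nonneg).2 fun T hT => ?_
  have hT' : circle.lipNorm ⟨T, fejerRieszTriple_smooth_le n T.2⟩ ≤ 1 :=
    (OperatorSystemSpectralTriple.lipNorm_eq (𝒯 := circle)
      (T := ⟨T, fejerRieszTriple_smooth_le n T.2⟩)
      ((fejerRieszTriple n).isCommutator_commutator T)).trans_le hT
  exact h.norm_sub_le φ ψ hT'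

/-- The Fejér map sends the Lipschitz ball of the circle into that of the smaller system, since it
commutes with `[D, ·]` and is contractive. -/
theorem dist_liftState_le (φ ψ : (fejerRieszTriple n).State) :
    dist (liftState n φ) (liftState n ψ) ≤ dist φ ψ := by
  refine (h.dist_le_iff dist_nonneg).2 fun T hT => ?_
  have hc := isCommutator_fejerSymbol n (circle.isCommutator_commutator T)
  have hT' : (fejerRieszTriple n).lipNorm ⟨_, mulOp_fejerSymbol_mem_E n T⟩ ≤ 1 := by
    refine (OperatorSystemSpectralTriple.lipNorm_eq (𝒯 := fejerRieszTriple n)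
      (T := ⟨_, mulOp_fejerSymbol_mem_E n T⟩) hc).trans_le ?_
    rw [norm_mulOp]
    exact (norm_fejerSymbol_le _ _).trans hT
  exact hn.norm_sub_le φ ψ hT'

-- The round trip is precomposition with the Fejér map, which moves each test element by at most
-- `π/√n`. The other round trip is the same.
omit mₙ hn in
theorem dist_liftState_restrictState_le (φ : circle.State) :
    dist φ (liftState n (restrictState n φ)) ≤ π / √n := by
  have := Real.pi_pos
  refine (h.dist_le_iff (by positivity)).2 fun T hT => ?_
  have e : (liftState n (restrictState n φ)).toFun (Submodule.inclusion circle.smooth_le T) =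
      φ.toFun ⟨_, fejerRieszTriple_E_le n (mulOp_fejerSymbol_mem_E n T)⟩ := rfl
  rw [e, ← map_sub, ← norm_neg, ← map_neg, neg_sub]
  exact (φ.norm_apply_le _).trans (isCircular_circle.norm_fejerSymbol_sub_le n.ne_zero hT)

omit m h in
theorem dist_restrictState_liftState_le (φ : (fejerRieszTriple n).State) :
    dist φ (restrictState n (liftState n φ)) ≤ π / √n := by
  have := Real.pi_pos
  refine (hn.dist_le_iff (by positivity)).2 fun T hT => ?_
  have e : (restrictState n (liftState n φ)).toFun
      (Submodule.inclusion (fejerRieszTriple n).smooth_le T) =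
      φ.toFun ⟨_, mulOp_fejerSymbol_mem_E n T⟩ := rfl
  rw [e, ← map_sub, ← norm_neg, ← map_neg, neg_sub]
  exact (φ.norm_apply_le _).trans
    ((isCircular_fejerRieszTriple n).norm_fejerSymbol_sub_le n.ne_zero hT)

theorem ghDist_le [CompactSpace (fejerRieszTriple n).State] [Nonempty (fejerRieszTriple n).State]
    [CompactSpace circle.State] [Nonempty circle.State] :
    GromovHausdorff.ghDist (fejerRieszTriple n).State circle.State ≤ 2 * (π / √n) := by
  -- The bound is `ε₁ + ε₂ / 2 + ε₃`: the lift is defined everywhere (`ε₁ = 0`), distorts distances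
  -- by at most `ε₂`, and has `ε₃`-dense image.
  have := GromovHausdorff.ghDist_le_of_approx_subsets 
    (s := (Set.univ : Set (fejerRieszTriple n).State))
    (fun φ => liftState n φ) (ε₁ := 0) (ε₂ := 2 * (π / √n)) (ε₃ := π / √n)
    (fun φ => ⟨φ, trivial, (dist_self φ).le⟩)
    (fun φ => ⟨⟨restrictState n φ, trivial⟩, dist_liftState_restrictState_le h φ⟩) ?_
  · linarith
  rintro ⟨φ, -⟩ ⟨ψ, -⟩
  change |dist φ ψ - dist (liftState n φ) (liftState n ψ)| ≤ _
  -- The lift can only shrink distances. Restricting back shrinks further but returns both points to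
  -- within `π/√n`, so at most `2π/√n` is lost.
  have h1 := dist_liftState_le hn h φ ψ
  have h2 := dist_restrictState_le hn h (liftState n φ) (liftState n ψ)
  have h3 := dist_restrictState_liftState_le hn φ
  have h4 := dist_restrictState_liftState_le hn ψ
  have h5 := dist_triangle4_right φ ψ (restrictState n (liftState n φ))
    (restrictState n (liftState n ψ))
  rw [abs_of_nonneg (sub_nonneg.2 h1)]
  linarith

end Dist

end CircleTriple

/-- For `n = 1, 2, …`, the distances `dₙ` on the state spaces of the Fejér–Riesz operator systems
and the distance `d` on the state space of `C(S¹)` are metrics inducing the weak-* topologies, the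
resulting metric spaces are compact and non-empty, and the Gromov–Hausdorff distance between
`(𝒮(C*(ℤ)₍ₙ₎), dₙ)` and `(𝒮(C(S¹)), d)` tends to zero. -/
theorem mainTheorem4 :
    ∃ (mₙ : ∀ n : ℕ+, MetricSpace (CircleTriple.fejerRieszTriple n).State)
      (m : MetricSpace CircleTriple.circle.State),
      (∀ n : ℕ+, (CircleTriple.fejerRieszTriple n).IsStateMetric (mₙ n)) ∧
      CircleTriple.circle.IsStateMetric m ∧
      ∃ (_ : ∀ n : ℕ+, CompactSpace (CircleTriple.fejerRieszTriple n).State)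
        (_ : ∀ n : ℕ+, Nonempty (CircleTriple.fejerRieszTriple n).State)
        (_ : CompactSpace CircleTriple.circle.State)
        (_ : Nonempty CircleTriple.circle.State),
        Tendsto (fun n : ℕ+ => GromovHausdorff.ghDist (CircleTriple.fejerRieszTriple n).State
          CircleTriple.circle.State) atTop (𝓝 0) := by
  have hn := fun n => (CircleTriple.isCircular_fejerRieszTriple n).isStateMetric
  have h := CircleTriple.isCircular_circle.isStateMetric
  let mₙ := fun n => OperatorSystemSpectralTriple.stateMetric
    (CircleTriple.isCircular_fejerRieszTriple n).stateEDist_ne_top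
  let m := OperatorSystemSpectralTriple.stateMetric
    CircleTriple.isCircular_circle.stateEDist_ne_top
  have cₙ := fun n => (hn n).compactSpace
  have c := h.compactSpace
  have eₙ := fun n => (CircleTriple.fejerRieszTriple n).nonempty_state
  have e := CircleTriple.circle.nonempty_state
  refine ⟨mₙ, m, hn, h, cₙ, eₙ, c, e, ?_⟩
  have hlim : Tendsto (fun n : ℕ+ => 2 * (π / √(n : ℕ))) atTop (𝓝 (2 * 0)) :=
    (Tendsto.div_atTop tendsto_const_nhds (Real.tendsto_sqrt_atTop.comp
      (tendsto_natCast_atTop_atTop.comp tendsto_PNat_val_atTop_atTop))).const_mul 2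
  rw [mul_zero] at hlim
  exact squeeze_zero (fun _ => dist_nonneg) (fun n => CircleTriple.ghDist_le (hn n) h) hlim
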